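/- Let $\Gamma\subset\mathbb R^3$ be a connected compact hypersurface of class $C^2$ bounding the bounded open set $D$ (its interior). Let $\phi$ be the signed distance function of $\Gamma$, i.e. $|\phi(x)|=\mathrm{dist}(x,\Gamma)$ with $\phi<0$ on $D$ and $\phi>0$ outside $D\cup\Gamma$. Put $\mathbf n=\nabla\phi$, $\mathbf H=D^2\phi$, $\mathbf p(x)=x-\phi(x)\mathbf n(x)$ and $\Omega_d=\{x\in\mathbb R^3:\mathrm{dist}(x,\Gamma)<d\}$. Let $\delta>0$ be such that the decomposition $x=y+r\,\mathbf n(y)$ with $y\in\Gamma$, $|r|<\delta$ is unique and $2\delta(|\kappa_1|+|\kappa_2|)\le 1$ on $\Gamma$, where $\kappa_1,\kappa_2$ are the principal curvatures (the eigenvalues of $\mathbf H$ on the tangent space). Let $\Omega\subset\mathbb R^3$ be open with $\Omega_\delta\subset\Omega$, and let $q\ge1$, $c>0$, $K>0$ be real numbers. Then there are $h_0>0$ and $C>0$, depending only on $\Gamma,\Omega,\delta,q,c,K$, with the following property. Let $0<h\le h_0$ and $0<d\le\delta$ with $h\le Kd$ (for a fixed $d$ this only says that $h$ is small enough). Let $\phi_h$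 be a continuous function on $\Omega$, with weak gradient (for instance, a continuous function that is piecewise smooth with respect to a triangulation of $\Omega$), such that $$\|\phi-\phi_h\|_{L^\infty(\Omega)}+h\,\|\nabla(\phi-\phi_h)\|_{L^\infty(\Omega)}\le c\,h^{q+1},$$ and such that $\Omega_h:=\{x\in\Omega:|\phi_h(x)|<d\}\subset\Omega_\delta$. Then there exists a continuous bijective map $\Phi_h:\Omega_h\to\Omega_d$ with $\Phi_h\in(W^{1,\infty}(\Omega_h))^3$, $\mathbf p(\Phi_h(x))=\mathbf p(x)$ for all $x\in\Omega_h$, and $$\|\mathrm{id}-\Phi_h\|_{L^\infty(\Omega_h)}+h\,\|\mathbf I-\mathrm D\Phi_h\|_{L^\infty(\Omega_h)}\le C\,h^{q+1},$$ where $\mathrm D\Phi_h$ is the weak Jacobian matrix, measured in the spectral norm. -/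

import Mathlib

open MeasureTheory Metric Set Topology
open scoped ENNReal ContDiff

/-- Three-dimensional Euclidean space. -/
abbrev E3 : Type := EuclideanSpace ℝ (Fin 3)

/-- `Γ` is a connected compact hypersurface of class `C²` in `ℝ³`, and `D` is its interior, the
bounded open region that it encloses: `Γ` is locally the zero set of a `C²` function with
non-vanishing derivative, and it is the boundary of `D`. (The last three fields determine `D`
from `Γ`: it is the bounded component of the complement of `Γ`.) -/
structure IsClosedC2Surface (Γ D : Set E3) : Prop where
  isCompact : IsCompact Γ
  isConnected : IsConnected Γ
  locally_zero_set : ∀ x ∈ Γ, ∃ f : E3 → ℝ, ContDiffAt ℝ 2 f x ∧ fderiv ℝ f x ≠ 0 ∧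
    ∀ᶠ y in 𝓝 x, (y ∈ Γ ↔ f y = 0)
  isOpen_interior : IsOpen D
  isBounded_interior : Bornology.IsBounded D
  frontier_interior : frontier D = Γ

open Classical in
/-- The signed distance function of `Γ`, negative in the interior `D` of `Γ` and positive in the
exterior. -/
noncomputable def signedDistFun (Γ D : Set E3) (x : E3) : ℝ :=
  if x ∈ D then -infDist x Γ else infDist x Γ

/-- The extended unit normal field `n = ∇φ`. -/
noncomputable def normalField (Γ D : Set E3) (x : E3) : E3 :=
  gradient (signedDistFun Γ D) x

/-- The Hessian `H = D²φ`, as the derivative of `n = ∇φ`. -/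
noncomputable def hessianField (Γ D : Set E3) (x : E3) : E3 →L[ℝ] E3 :=
  fderiv ℝ (normalField Γ D) x

/-- The projection `p(x) = x - φ(x) n(x)` onto `Γ`. -/
noncomputable def projGamma (Γ D : Set E3) (x : E3) : E3 :=
  x - signedDistFun Γ D x • normalField Γ D x

/-- `κ₁` and `κ₂` are the two principal curvatures at `x`: the eigenvalues of `H(x)` for an
orthonormal pair of eigenvectors orthogonal to `n(x)`. -/
def ArePrincipalCurvatures (Γ D : Set E3) (x : E3) (κ₁ κ₂ : ℝ) : Prop :=
  ∃ v w : E3, ‖v‖ = 1 ∧ ‖w‖ = 1 ∧ inner ℝ v w = 0 ∧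
    inner ℝ v (normalField Γ D x) = 0 ∧ inner ℝ w (normalField Γ D x) = 0 ∧
    hessianField Γ D x v = κ₁ • v ∧ hessianField Γ D x w = κ₂ • w

/-- `δ` is an admissible width of the tubular neighbourhood `{dist(·,Γ) < δ}`: the
decomposition `x = y + r n(y)` with `y ∈ Γ` and `|r| < δ` is unique, and
`δ ≤ (2 max_Γ (|κ₁| + |κ₂|))⁻¹`. -/
structure IsAdmissibleWidth (Γ D : Set E3) (δ : ℝ) : Prop where
  pos : 0 < δ
  unique_decomposition : ∀ y ∈ Γ, ∀ z ∈ Γ, ∀ r s : ℝ, |r| < δ → |s| < δ →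
    y + r • normalField Γ D y = z + s • normalField Γ D z → y = z ∧ r = s
  curvature_le : ∀ x ∈ Γ, ∀ κ₁ κ₂ : ℝ, ArePrincipalCurvatures Γ D x κ₁ κ₂ →
    2 * δ * (|κ₁| + |κ₂|) ≤ 1

/-- `G` is the weak derivative of `f` in the open set `U`. -/
structure HasWeakFDeriv {F : Type*} [NormedAddCommGroup F] [NormedSpace ℝ F]
    (U : Set E3) (f : E3 → F) (G : E3 → E3 →L[ℝ] F) : Prop where
  locallyIntegrableOn : LocallyIntegrableOn f U
  locallyIntegrableOn_deriv : LocallyIntegrableOn G U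
  integral_eq : ∀ ψ : E3 → ℝ, ContDiff ℝ ∞ ψ → HasCompactSupport ψ → tsupport ψ ⊆ U →
    ∀ v : E3, ∫ x in U, (fderiv ℝ ψ x v) • f x = -∫ x in U, ψ x • G x v

/-- The `L^∞(U)` norm, with values in `[0, ∞]`; linear maps carry the operator norm induced by
the Euclidean norm. -/
noncomputable def supNorm {F : Type*} [NormedAddCommGroup F] (U : Set E3) (f : E3 → F) : ℝ≥0∞ :=
  eLpNorm f ∞ (volume.restrict U)

/-- `f` belongs to `W^{1,∞}(U)`, with weak derivative `G`. -/
structure IsW1InfWith {F : Type*} [NormedAddCommGroup F] [NormedSpace ℝ F]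
    (U : Set E3) (f : E3 → F) (G : E3 → E3 →L[ℝ] F) : Prop where
  hasWeakFDeriv : HasWeakFDeriv U f G
  memLp : MemLp f ∞ (volume.restrict U)
  memLp_deriv : MemLp G ∞ (volume.restrict U)

/-- The approximate narrow band `Ω_h = {x ∈ Ω : |φ_h(x)| < d}`. -/
def discreteBand (Ω : Set E3) (φh : E3 → ℝ) (d : ℝ) : Set E3 :=
  {x ∈ Ω | |φh x| < d}

/-!
Write `φ` for the signed distance, `n = ∇φ`, `p` for the projection, `e = φ_h - φ` and
`ε = c h ^ (q + 1)`. The map is a displacement along the normals, `Φ_h(x) = x + E(x) n(x)`: since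
`n` is constant along normals, `p ∘ Φ_h = p`, and the height `φ(x)` is replaced by `φ(x) + E(x)`.

The obvious choice `E = e`, which replaces the height by `φ_h`, fails to be onto when `d` is close
to `δ`: the discrete band then ends at the edge of the tubular neighbourhood, where `φ_h` may not
have reached `±d`. Therefore `e` is clamped (`bandCorrection`): at heights near `d` it is kept
above `-(δ - d)`, at heights near `-d` it is kept below `δ - d`, and the two clamps are interpolated
by a function of `φ` with slope `ε / d`, which is `O(h ^ q)` because `h ≤ K d`. The clamped
correction is no larger than `e`, cuts out the same band (`abs_add_bandCorrection_lt_iff`), and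
its corrected heights tend to at least `d` and at most `-d` at the two ends of each normal.
It is locally Lipschitz with a constant `O(h ^ q) < 1`, so that the corrected height is strictly
increasing along each normal, and the intermediate value theorem gives the bijection
(`IsClosedC2Surface.bijOn_add_smul_normalField`).

Two ingredients are needed. The geometric one is the regularity of `φ` up to the edge of the tubular
neighbourhood. Connectedness of `Γ` puts `D` on exactly one side of `Γ` near each point
(`IsClosedC2Surface.exists_defining_function`). The inverse function theorem for
`(y, r) ↦ (y + r n(y), f y)` gives `C¹` normal coordinates (`exists_normal_coordinates`); it is
used with a defining function `f` near `Γ`, to see that `n` is `C¹` there, and then with `f = φ` on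
the whole neighbourhood, where uniqueness of the decomposition identifies the height with `φ` and
the curvature bound makes the derivative invertible and gives `‖D²φ‖ ≤ 1 / δ`
(`IsClosedC2Surface.normalField_add_smul`). The analytic one is the identification of `W^{1,∞}` with
Lipschitz functions: mollification in one direction (`HasWeakFDeriv.exists_lipschitzOnWith`),
Rademacher's theorem in the other (`isW1InfWith_of_locally_lipschitz`).
-/

/-! ### The two sides of a closed surface -/

theorem IsPreconnected.mem_iff_mem_of_disjoint_frontier {X : Type*} [TopologicalSpace X]
    {S D : Set X} (hS : IsPreconnected S) (hD : IsOpen D) (h : Disjoint S (frontier D))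
    {x y : X} (hx : x ∈ S) (hy : y ∈ S) : x ∈ D ↔ y ∈ D := by
  have key : ∀ x y : X, x ∈ S → y ∈ S → x ∈ D → y ∈ D := by
    intro x y hx hy hxD
    have hsub : S ⊆ D ∪ (closure D)ᶜ := by
      intro z hz
      by_cases hzD : z ∈ D
      · exact Or.inl hzD
      · refine Or.inr fun hzc => h.le_bot ⟨hz, ?_⟩
        rw [hD.frontier_eq]
        exact ⟨hzc, hzD⟩
    have hdis : Disjoint D (closure D)ᶜ :=
      disjoint_compl_right_iff_subset.2 subset_closure
    exact hS.subset_left_of_subset_union hD isClosed_closure.isOpen_compl hdis hsub ⟨x, hx, hxD⟩ hy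
  exact ⟨key x y hx hy, key y x hy hx⟩

/-- The values of a strictly differentiable function increase at a uniform rate along a direction
in which its derivative is positive. -/
theorem HasStrictFDerivAt.eventually_add_smul_ge {E : Type*} [NormedAddCommGroup E]
    [NormedSpace ℝ E] {f : E → ℝ} {f' : E →L[ℝ] ℝ} {x₀ e : E} (hf : HasStrictFDerivAt f f' x₀)
    (he : 0 < f' e) :
    ∀ᶠ p : E × ℝ in 𝓝 (x₀, 0), 0 ≤ p.2 → f p.1 + p.2 * (f' e / 2) ≤ f (p.1 + p.2 • e) := by
  have he0 : e ≠ 0 := by rintro rfl; simp at he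
  have hen : 0 < ‖e‖ := norm_pos_iff.2 he0
  have h1 := hf.isLittleO.def (c := f' e / (2 * ‖e‖)) (by positivity)
  have h2 : Filter.Tendsto (fun p : E × ℝ => (p.1 + p.2 • e, p.1)) (𝓝 (x₀, 0)) (𝓝 (x₀, x₀)) := by
    have : Continuous (fun p : E × ℝ => (p.1 + p.2 • e, p.1)) := by fun_prop
    simpa using this.tendsto (x₀, 0)
  filter_upwards [h2.eventually h1] with p hp hp0
  simp only [add_sub_cancel_left, map_smul, smul_eq_mul, norm_smul, Real.norm_eq_abs,
    abs_of_nonneg hp0] at hp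
  have h3 : f' e / (2 * ‖e‖) * (p.2 * ‖e‖) = p.2 * (f' e / 2) := by field_simp
  rw [h3] at hp
  linarith [(abs_le.1 hp).1]

/-- On either side of a regular level set, membership in an open set whose frontier is this level
set does not depend on the point: all points slightly above the level set can be moved, by a
translation in an increasing direction, into one and the same ball, without meeting the level
set. -/
theorem exists_side_mem_iff {E : Type*} [NormedAddCommGroup E] [NormedSpace ℝ E]
    {D : Set E} (hD : IsOpen D) {f : E → ℝ} {f' : E →L[ℝ] ℝ} {x₀ : E}
    (hf : HasStrictFDerivAt f f' x₀) (hf' : f' ≠ 0) (h0 : f x₀ = 0)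
    (hΓ : ∀ᶠ y in 𝓝 x₀, (y ∈ frontier D ↔ f y = 0)) :
    ∃ P : Prop, ∀ᶠ x in 𝓝 x₀, 0 < f x → (x ∈ D ↔ P) := by
  obtain ⟨e, he⟩ : ∃ e, 0 < f' e := by
    by_contra! hcon
    refine hf' (ContinuousLinearMap.ext fun v => le_antisymm (hcon v) ?_)
    have := hcon (-v)
    simp at this
    simpa using this
  have h1 := hf.eventually_add_smul_ge he
  have hcont : Continuous (fun p : E × ℝ => p.1 + p.2 • e) := by fun_prop
  have hcf : ∀ᶠ y in 𝓝 x₀, ContinuousAt f y := by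
    obtain ⟨K, s, hs, hK⟩ := hf.exists_lipschitzOnWith
    filter_upwards [eventually_mem_nhds_iff.2 hs] with y hy using hK.continuousOn.continuousAt hy
  have h2 : ∀ᶠ p : E × ℝ in 𝓝 (x₀, 0), (p.1 + p.2 • e ∈ frontier D ↔ f (p.1 + p.2 • e) = 0) ∧
      ContinuousAt f (p.1 + p.2 • e) :=
    (by simpa using hcont.tendsto (x₀, 0) : Filter.Tendsto _ _ (𝓝 x₀)).eventually (hΓ.and hcf)
  obtain ⟨R, hR, hball⟩ := Metric.eventually_nhds_iff_ball.1 (h1.and h2)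
  set η := R / 2 with hη
  have hη0 : 0 < η := by positivity
  have hz : 0 < f (x₀ + η • e) := by
    have := (hball (x₀, η) (by
      rw [← ball_prod_same]; exact ⟨mem_ball_self hR, by simp [abs_of_pos hη0]; linarith⟩)).1 hη0.le
    simp only [h0] at this
    nlinarith [mul_pos hη0 he]
  have hin : ∀ x ∈ ball x₀ R, ∀ t : ℝ, 0 ≤ t → t ≤ η → f x ≤ f (x + t • e) ∧
      (x + t • e ∈ frontier D ↔ f (x + t • e) = 0) := by
    intro x hx t ht htη
    have := hball (x, t) (by
      rw [← ball_prod_same]; exact ⟨hx, by simp [abs_of_nonneg ht]; linarith⟩)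
    refine ⟨?_, this.2.1⟩
    have h3 := this.1 ht
    have : 0 ≤ t * (f' e / 2) := by positivity
    simp only at h3
    linarith
  -- the translates by `η • e` of the points near `x₀` fill a ball on which `f` is positive
  have hfz : ∀ᶠ x in 𝓝 x₀, 0 < f (x + η • e) := by
    have hc : ContinuousAt f (x₀ + η • e) := (hball (x₀, η) (by
      rw [← ball_prod_same]
      exact ⟨mem_ball_self hR, by simp [abs_of_pos hη0]; linarith⟩)).2.2
    have ht : Filter.Tendsto (fun x : E => x + η • e) (𝓝 x₀) (𝓝 (x₀ + η • e)) :=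
      (continuous_id.add continuous_const).tendsto _
    exact ht.eventually (hc.eventually_const_lt hz)
  obtain ⟨ρ, hρ, hρball⟩ := Metric.eventually_nhds_iff_ball.1 hfz
  refine ⟨x₀ + η • e ∈ D, ?_⟩
  filter_upwards [ball_mem_nhds x₀ (lt_min hρ hR)] with x hx hfx
  have hxρ : x ∈ ball x₀ ρ := ball_subset_ball (min_le_left _ _) hx
  have hxR : x ∈ ball x₀ R := ball_subset_ball (min_le_right _ _) hx
  have hstep1 : x ∈ D ↔ x + η • e ∈ D := by
    have hS : IsPreconnected (segment ℝ x (x + η • e)) := (convex_segment _ _).isPreconnected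
    refine hS.mem_iff_mem_of_disjoint_frontier hD ?_ (left_mem_segment _ _ _)
      (right_mem_segment _ _ _)
    rw [Set.disjoint_left]
    intro y hy
    rw [segment_eq_image'] at hy
    obtain ⟨θ, hθ, rfl⟩ := hy
    have := hin x hxR (θ * η) (mul_nonneg hθ.1 hη0.le) (mul_le_of_le_one_left hη0.le hθ.2)
    simp only [add_sub_cancel_left, smul_smul]
    rw [this.2]
    exact (hfx.trans_le this.1).ne'
  have hstep2 : x + η • e ∈ D ↔ x₀ + η • e ∈ D := by
    have hS : IsPreconnected ((fun y => y + η • e) '' ball x₀ (min ρ R)) :=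
      (convex_ball _ _).isPreconnected.image _ (by fun_prop)
    refine hS.mem_iff_mem_of_disjoint_frontier hD ?_ (mem_image_of_mem _ hx)
      (mem_image_of_mem _ (mem_ball_self (lt_min hρ hR)))
    rw [Set.disjoint_left]
    rintro _ ⟨y, hy, rfl⟩
    have hyρ : y ∈ ball x₀ ρ := ball_subset_ball (min_le_left _ _) hy
    have hyR : y ∈ ball x₀ R := ball_subset_ball (min_le_right _ _) hy
    simp only
    rw [(hin y hyR η hη0.le le_rfl).2]
    exact (hρball y hyρ).ne'
  exact hstep1.trans hstep2

/-- Near each of its points, the surface is a regular level set of a `C²` function that is negative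
exactly on `D`. -/
theorem IsClosedC2Surface.exists_defining_function {Γ D : Set E3} (hΓ : IsClosedC2Surface Γ D)
    {x : E3} (hx : x ∈ Γ) : ∃ f : E3 → ℝ, ContDiffAt ℝ 2 f x ∧ fderiv ℝ f x ≠ 0 ∧
      (∀ᶠ y in 𝓝 x, (y ∈ Γ ↔ f y = 0)) ∧ ∀ᶠ y in 𝓝 x, (y ∈ D ↔ f y < 0) := by
  have hDo := hΓ.isOpen_interior
  have hfr := hΓ.frontier_interior
  have hdisj : ∀ z ∈ Γ, z ∉ D := by
    intro z hz hzD
    have : z ∈ D ∩ frontier D := ⟨hzD, hfr ▸ hz⟩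
    rw [hDo.inter_frontier_eq] at this
    exact this
  have hcl : ∀ z, z ∈ closure D ↔ z ∈ D ∨ z ∈ Γ := by
    intro z
    rw [closure_eq_self_union_frontier, hfr, mem_union]
  -- either both sides of the surface belong to `D` near `y`, or exactly one does
  have hdich : ∀ y ∈ Γ, y ∈ interior (closure D) ∨
      ((∀ᶠ z in 𝓝 y, z ∈ Γ → z ∉ interior (closure D)) ∧
        ∃ f : E3 → ℝ, ContDiffAt ℝ 2 f y ∧ fderiv ℝ f y ≠ 0 ∧
          (∀ᶠ z in 𝓝 y, (z ∈ Γ ↔ f z = 0)) ∧ ∀ᶠ z in 𝓝 y, (z ∈ D ↔ f z < 0)) := by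
    intro y hy
    obtain ⟨f, hf, hf', hfΓ⟩ := hΓ.locally_zero_set y hy
    have hfy : f y = 0 := hfΓ.self_of_nhds.1 hy
    have hs := hf.hasStrictFDerivAt (by norm_num)
    have hgood : ∀ g : E3 → ℝ, ContDiffAt ℝ 2 g y → fderiv ℝ g y ≠ 0 →
        (∀ᶠ z in 𝓝 y, (z ∈ Γ ↔ g z = 0)) → (∀ᶠ z in 𝓝 y, (z ∈ D ↔ g z < 0)) →
        ∀ᶠ z in 𝓝 y, z ∈ Γ → z ∉ interior (closure D) := by
      intro g hg hg' hgΓ hgD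
      have hne : ∀ᶠ z in 𝓝 y, fderiv ℝ g z ≠ 0 :=
        ((hg.fderiv_right (m := 1) (by norm_num)).continuousAt).eventually_ne hg'
      filter_upwards [hne, eventually_eventually_nhds.2 hgΓ, eventually_eventually_nhds.2 hgD]
        with z hz1 hz2 hz3 hzΓ hzi
      refine hz1 (IsLocalMax.fderiv_eq_zero ?_)
      filter_upwards [hz2, hz3, mem_interior_iff_mem_nhds.1 hzi] with w hw1 hw2 hw3
      rw [hz2.self_of_nhds.1 hzΓ]
      rcases (hcl w).1 hw3 with h | h
      · exact (hw2.1 h).le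
      · exact (hw1.1 h).le
    obtain ⟨P, hP⟩ := exists_side_mem_iff hDo hs hf' hfy (by rwa [hfr])
    obtain ⟨Q, hQ⟩ := exists_side_mem_iff (f := fun z => -f z) (f' := -fderiv ℝ f y) hDo hs.fun_neg
      (neg_ne_zero.2 hf') (by simp [hfy]) (by rw [hfr]; simpa using hfΓ)
    have hnegd : fderiv ℝ (fun z => -f z) y = -fderiv ℝ f y := fderiv_fun_neg
    by_cases hPt : P <;> by_cases hQt : Q
    · left
      rw [mem_interior_iff_mem_nhds]
      filter_upwards [hfΓ, hP, hQ] with z h1 h2 h3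
      rw [hcl]
      rcases lt_trichotomy (f z) 0 with h | h | h
      · exact Or.inl ((h3 (by linarith)).2 hQt)
      · exact Or.inr (h1.2 h)
      · exact Or.inl ((h2 h).2 hPt)
    · right
      have hD' : ∀ᶠ z in 𝓝 y, (z ∈ D ↔ -f z < 0) := by
        filter_upwards [hfΓ, hP, hQ] with z h1 h2 h3
        rcases lt_trichotomy (f z) 0 with h | h | h
        · have := h3 (by linarith)
          constructor
          · intro h'; exact absurd (this.1 h') hQt
          · intro h'; linarith
        · constructor
          · intro h'; exact absurd h' (hdisj z (h1.2 h))
          · intro h'; linarith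
        · exact ⟨fun _ => by linarith, fun _ => (h2 h).2 hPt⟩
      have hΓ' : ∀ᶠ z in 𝓝 y, (z ∈ Γ ↔ -f z = 0) := by simpa using hfΓ
      have hd' : fderiv ℝ (fun z => -f z) y ≠ 0 := by rw [hnegd]; exact neg_ne_zero.2 hf'
      exact ⟨hgood _ hf.neg hd' hΓ' hD', fun z => -f z, hf.neg, hd', hΓ', hD'⟩
    · right
      have hD' : ∀ᶠ z in 𝓝 y, (z ∈ D ↔ f z < 0) := by
        filter_upwards [hfΓ, hP, hQ] with z h1 h2 h3
        rcases lt_trichotomy (f z) 0 with h | h | h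
        · exact ⟨fun _ => by linarith, fun _ => (h3 (by linarith)).2 hQt⟩
        · constructor
          · intro h'; exact absurd h' (hdisj z (h1.2 h))
          · intro h'; linarith
        · have := h2 h
          constructor
          · intro h'; exact absurd (this.1 h') hPt
          · intro h'; linarith
      exact ⟨hgood _ hf hf' hfΓ hD', f, hf, hf', hfΓ, hD'⟩
    · exfalso
      have hyc : y ∈ closure D := (hcl y).2 (Or.inr hy)
      rw [mem_closure_iff_frequently] at hyc
      refine hyc ?_
      filter_upwards [hfΓ, hP, hQ] with z h1 h2 h3 hzD
      rcases lt_trichotomy (f z) 0 with h | h | h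
      · exact hQt ((h3 (by linarith)).1 hzD)
      · exact hdisj z (h1.2 h) hzD
      · exact hPt ((h2 h).1 hzD)
  -- since `Γ` is connected, the same alternative holds at all its points, and the first one is
  -- impossible because `closure D` would be open, closed and bounded
  have hnone : ∀ y ∈ Γ, y ∉ interior (closure D) := by
    intro y₀ hy₀ hy₀i
    have hall : Γ ⊆ interior (closure D) := by
      have hV : IsOpen {y : E3 | ∀ᶠ z in 𝓝 y, z ∈ Γ → z ∉ interior (closure D)} :=
        isOpen_setOfPred_eventually_nhds
      by_contra hcon
      obtain ⟨y₁, hy₁, hy₁i⟩ := Set.not_subset.1 hcon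
      obtain ⟨z, hzΓ, hzi, hzV⟩ := hΓ.isConnected.isPreconnected _ _ _root_.isOpen_interior hV
        (fun y hy => (hdich y hy).imp id fun h => h.1) ⟨y₀, hy₀, hy₀i⟩
        ⟨y₁, hy₁, ((hdich y₁ hy₁).resolve_left hy₁i).1⟩
      exact hzV.self_of_nhds hzΓ hzi
    have hopen : IsOpen (closure D) := by
      rw [← subset_interior_iff_isOpen]
      intro z hz
      rcases (hcl z).1 hz with h | h
      · exact interior_mono subset_closure (hDo.interior_eq.symm ▸ h)
      · exact hall h
    have huniv : closure D = univ :=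
      IsClopen.eq_univ ⟨isClosed_closure, hopen⟩ ⟨y₀, (hcl y₀).2 (Or.inr hy₀)⟩
    have hb := hΓ.isBounded_interior.closure
    rw [huniv] at hb
    exact NormedSpace.unbounded_univ ℝ E3 hb
  exact ((hdich x hx).resolve_left (hnone x hx)).2

/-! ### Normal coordinates and nearest points -/

section NormalCoordinates

variable {E : Type*} [NormedAddCommGroup E] [InnerProductSpace ℝ E]

theorem inner_fderiv_eq_zero_of_norm_eq_one {N : E → E} {z : E} (hN : DifferentiableAt ℝ N z)
    (h1 : ∀ᶠ y in 𝓝 z, ‖N y‖ = 1) (u : E) : inner ℝ (N z) (fderiv ℝ N z u) = 0 := by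
  have h2 : HasFDerivAt (fun y => ‖N y‖ ^ 2) _ z := hN.hasFDerivAt.norm_sq
  have h3 : HasFDerivAt (fun y => ‖N y‖ ^ 2) (0 : E →L[ℝ] ℝ) z := by
    refine (hasFDerivAt_const (1 : ℝ) z).congr_of_eventuallyEq ?_
    filter_upwards [h1] with y hy
    simp [hy]
  have h4 := congrArg (fun T : E →L[ℝ] ℝ => T u) (h2.unique h3)
  simpa using h4

/-- Normal coordinates: if `N` is a unit field normal to the level sets of `f`, then the points
near `y₀ + r₀ N(y₀)` can be written uniquely as `y + r N(y)` with `f y = 0` and `(y, r)` near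
`(y₀, r₀)`. The foot point `P` and the signed height `R` are `C¹`, and the gradient of `R` is the
normal at the foot point. This comes from the inverse function theorem for the map
`(y, r) ↦ (y + r N(y), f y)` of `E × ℝ` to itself, which avoids charts of the surface. -/
theorem exists_normal_coordinates [FiniteDimensional ℝ E] {f : E → ℝ} {N : E → E} {y₀ : E}
    (r₀ : ℝ) (hf : ContDiffAt ℝ 1 f y₀) (hN : ContDiffAt ℝ 1 N y₀)
    (hN1 : ∀ᶠ y in 𝓝 y₀, ‖N y‖ = 1)
    (hfN : ∀ᶠ y in 𝓝 y₀, ∃ a : ℝ, a ≠ 0 ∧ ∀ v, fderiv ℝ f y v = a * inner ℝ (N y) v)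
    (h0 : f y₀ = 0)
    (hinj : ∀ v, inner ℝ (N y₀) v = 0 → v + r₀ • fderiv ℝ N y₀ v = 0 → v = 0) :
    ∃ (P : E → E) (R : E → ℝ), ContDiffAt ℝ 1 P (y₀ + r₀ • N y₀) ∧
      P (y₀ + r₀ • N y₀) = y₀ ∧ R (y₀ + r₀ • N y₀) = r₀ ∧ ContinuousAt R (y₀ + r₀ • N y₀) ∧
      (∀ᶠ x in 𝓝 (y₀ + r₀ • N y₀), f (P x) = 0 ∧ x = P x + R x • N (P x) ∧
        HasGradientAt R (N (P x)) x ∧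
        ∀ v, v = fderiv ℝ P x v + R x • fderiv ℝ N (P x) (fderiv ℝ P x v)
          + inner ℝ (N (P x)) v • N (P x)) ∧
      ∀ᶠ p : E × ℝ in 𝓝 (y₀, r₀), f p.1 = 0 →
        P (p.1 + p.2 • N p.1) = p.1 ∧ R (p.1 + p.2 • N p.1) = p.2 := by
  set F : E × ℝ → E × ℝ := fun p => (p.1 + p.2 • N p.1, f p.1) with hF
  have hNd : HasFDerivAt N (fderiv ℝ N y₀) y₀ := (hN.differentiableAt (by norm_num)).hasFDerivAt
  have hfd : HasFDerivAt f (fderiv ℝ f y₀) y₀ := (hf.differentiableAt (by norm_num)).hasFDerivAt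
  have hFc : ContDiffAt ℝ 1 F (y₀, r₀) := by
    have h1 : ContDiffAt ℝ 1 (fun p : E × ℝ => N p.1) (y₀, r₀) :=
      ContDiffAt.comp (y₀, r₀) hN contDiffAt_fst
    have h2 : ContDiffAt ℝ 1 (fun p : E × ℝ => f p.1) (y₀, r₀) :=
      ContDiffAt.comp (y₀, r₀) hf contDiffAt_fst
    exact (contDiffAt_fst.add (contDiffAt_snd.smul h1)).prodMk h2
  set T : E × ℝ →L[ℝ] E × ℝ := fderiv ℝ F (y₀, r₀) with hT
  have hFd : HasFDerivAt F T (y₀, r₀) := (hFc.differentiableAt (by norm_num)).hasFDerivAt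
  have hTv : ∀ (v : E) (s : ℝ),
      T (v, s) = (v + (r₀ • fderiv ℝ N y₀ v + s • N y₀), fderiv ℝ f y₀ v) := by
    intro v s
    have h1 : HasFDerivAt (fun p : E × ℝ => N p.1) _ (y₀, r₀) :=
      HasFDerivAt.comp (y₀, r₀) hNd hasFDerivAt_fst
    have h2 : HasFDerivAt (fun p : E × ℝ => f p.1) _ (y₀, r₀) :=
      HasFDerivAt.comp (y₀, r₀) hfd hasFDerivAt_fst
    have h3 := (hasFDerivAt_fst.add (hasFDerivAt_snd.smul h1)).prodMk h2
    have h4 := congrArg (fun A : E × ℝ →L[ℝ] E × ℝ => A (v, s)) (hFd.unique h3)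
    simpa using h4
  have hTinj : Function.Injective T.toLinearMap := by
    rw [← LinearMap.ker_eq_bot, LinearMap.ker_eq_bot']
    rintro ⟨v, s⟩ hvs
    have hvs' : T (v, s) = 0 := hvs
    rw [hTv, Prod.mk_eq_zero] at hvs'
    obtain ⟨a, ha, hav⟩ := hfN.self_of_nhds
    have hNv : inner ℝ (N y₀) v = 0 := by
      have := hvs'.2
      rw [hav] at this
      exact (mul_eq_zero.1 this).resolve_left ha
    have hs : s = 0 := by
      have := congrArg (fun w => inner ℝ (N y₀) w) hvs'.1
      simpa [inner_add_right, inner_smul_right, hNv, hN1.self_of_nhds,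
        inner_fderiv_eq_zero_of_norm_eq_one (hN.differentiableAt (by norm_num)) hN1,
        real_inner_self_eq_norm_sq] using this
    subst hs
    have hv : v = 0 := hinj v hNv (by simpa using hvs'.1)
    simp [hv]
  let L : (E × ℝ) ≃L[ℝ] (E × ℝ) :=
    (LinearEquiv.ofInjectiveEndo T.toLinearMap hTinj).toContinuousLinearEquiv
  have hLT : (L : E × ℝ →L[ℝ] E × ℝ) = T := by
    ext p <;> rfl
  have hFL : HasFDerivAt F (L : E × ℝ →L[ℝ] E × ℝ) (y₀, r₀) := by rw [hLT]; exact hFd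
  have hFs : HasStrictFDerivAt F (L : E × ℝ →L[ℝ] E × ℝ) (y₀, r₀) :=
    hFc.hasStrictFDerivAt' hFL (by norm_num)
  set G : E × ℝ → E × ℝ := hFs.localInverse F L (y₀, r₀) with hG
  have hGc : ContDiffAt ℝ 1 G (F (y₀, r₀)) := hFc.to_localInverse hFL (by norm_num)
  have hF0 : F (y₀, r₀) = (y₀ + r₀ • N y₀, 0) := by simp [hF, h0]
  have hG0 : G (y₀ + r₀ • N y₀, 0) = (y₀, r₀) := by
    rw [← hF0]; exact hFs.localInverse_apply_image
  rw [hF0] at hGc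
  set x₀ := y₀ + r₀ • N y₀ with hx₀
  have hι : ContDiffAt ℝ 1 (fun x : E => (x, (0 : ℝ))) x₀ := contDiffAt_id.prodMk contDiffAt_const
  have hGι : ContDiffAt ℝ 1 (fun x => G (x, 0)) x₀ := ContDiffAt.comp x₀ hGc hι
  have hP : ContDiffAt ℝ 1 (fun x => (G (x, 0)).1) x₀ := hGι.fst
  have hR : ContDiffAt ℝ 1 (fun x => (G (x, 0)).2) x₀ := hGι.snd
  refine ⟨fun x => (G (x, 0)).1, fun x => (G (x, 0)).2, hP, by simp [hG0], by simp [hG0],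
    hR.continuousAt, ?_, ?_⟩
  · have hright : ∀ᶠ x in 𝓝 x₀, F (G (x, 0)) = (x, 0) := by
      have h1 := hFs.eventually_right_inverse
      rw [hF0] at h1
      exact hι.continuousAt.eventually h1
    have hPt : Filter.Tendsto (fun x => (G (x, 0)).1) (𝓝 x₀) (𝓝 y₀) := by
      have := hP.continuousAt.tendsto
      simpa [hG0] using this
    have hfD : ∀ᶠ y in 𝓝 y₀, DifferentiableAt ℝ f y :=
      (hf.eventually (by simp)).mono fun y hy => hy.differentiableAt (by norm_num)
    have hND : ∀ᶠ y in 𝓝 y₀, DifferentiableAt ℝ N y :=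
      (hN.eventually (by simp)).mono fun y hy => hy.differentiableAt (by norm_num)
    have hPD := (hP.eventually (by simp)).mono fun y hy => hy.differentiableAt (by norm_num)
    have hRD := (hR.eventually (by simp)).mono fun y hy => hy.differentiableAt (by norm_num)
    filter_upwards [eventually_eventually_nhds.2 hright, hPt.eventually hfD, hPt.eventually hND,
      hPt.eventually hfN, hPt.eventually (eventually_eventually_nhds.2 hN1), hPD, hRD]
      with x hx hfx hNx hfNx hN1x hPx hRx
    set P : E → E := fun x => (G (x, 0)).1 with hPdef
    set R : E → ℝ := fun x => (G (x, 0)).2 with hRdef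
    have hxP : ∀ᶠ z in 𝓝 x, z = P z + R z • N (P z) :=
      hx.mono fun z hz => (congrArg Prod.fst hz).symm
    have hfP : ∀ᶠ z in 𝓝 x, f (P z) = 0 := hx.mono fun z hz => congrArg Prod.snd hz
    have hNPd : HasFDerivAt (fun z => N (P z)) ((fderiv ℝ N (P x)).comp (fderiv ℝ P x)) x :=
      HasFDerivAt.comp x hNx.hasFDerivAt hPx.hasFDerivAt
    have hfPd : HasFDerivAt (fun z => f (P z)) ((fderiv ℝ f (P x)).comp (fderiv ℝ P x)) x :=
      HasFDerivAt.comp x hfx.hasFDerivAt hPx.hasFDerivAt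
    have htan : ∀ v, inner ℝ (N (P x)) (fderiv ℝ P x v) = 0 := by
      intro v
      have h1 : HasFDerivAt (fun z => f (P z)) (0 : E →L[ℝ] ℝ) x :=
        (hasFDerivAt_const (0 : ℝ) x).congr_of_eventuallyEq hfP
      have h2 := congrArg (fun A : E →L[ℝ] ℝ => A v) (hfPd.unique h1)
      obtain ⟨a, ha, hav⟩ := hfNx
      simp only [ContinuousLinearMap.comp_apply, zero_apply] at h2
      rw [hav] at h2
      exact (mul_eq_zero.1 h2).resolve_left ha
    have hid : ∀ v, v = fderiv ℝ P x v + R x • fderiv ℝ N (P x) (fderiv ℝ P x v)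
        + fderiv ℝ R x v • N (P x) := by
      intro v
      have h1 : HasFDerivAt (fun z => P z + R z • N (P z)) (ContinuousLinearMap.id ℝ E) x :=
        (hasFDerivAt_id x).congr_of_eventuallyEq (hxP.mono fun z hz => hz.symm)
      have h2 := hPx.hasFDerivAt.add (hRx.hasFDerivAt.smul hNPd)
      have h3 := congrArg (fun A : E →L[ℝ] E => A v) (h1.unique h2)
      simpa [add_assoc] using h3
    have hN1P : ‖N (P x)‖ = 1 := hN1x.self_of_nhds
    have hort : ∀ u, inner ℝ (N (P x)) (fderiv ℝ N (P x) u) = 0 :=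
      inner_fderiv_eq_zero_of_norm_eq_one hNx hN1x
    have hDR : ∀ v, fderiv ℝ R x v = inner ℝ (N (P x)) v := by
      intro v
      have h1 := congrArg (fun w => inner ℝ (N (P x)) w) (hid v)
      simp only [inner_add_right, inner_smul_right, htan, zero_add, mul_zero,
        hort, real_inner_self_eq_norm_sq, hN1P] at h1
      simpa using h1.symm
    refine ⟨hfP.self_of_nhds, hxP.self_of_nhds, ?_, ?_⟩
    · rw [hasGradientAt_iff_hasFDerivAt]
      have h1 : InnerProductSpace.toDual ℝ E (N (P x)) = fderiv ℝ R x := by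
        ext v
        simp [hDR]
      rw [h1]
      exact hRx.hasFDerivAt
    · intro v
      rw [← hDR v]
      exact hid v
  · filter_upwards [hFs.eventually_left_inverse] with p hp hfp
    have h1 : G (p.1 + p.2 • N p.1, 0) = p := by
      have : F p = (p.1 + p.2 • N p.1, 0) := by simp [hF, hfp]
      rw [← this]; exact hp
    simp [h1]

/-- The vector from a nearest point of a regular level set is normal to it. -/
theorem exists_eq_add_smul_normal [CompleteSpace E] {Γ : Set E} {f : E → ℝ} {f' : E →L[ℝ] ℝ}
    {ν x y : E} {a : ℝ} (hy : y ∈ Γ) (hmin : ∀ z ∈ Γ, dist x y ≤ dist x z)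
    (hf : HasStrictFDerivAt f f' y) (ha : a ≠ 0) (hν : ‖ν‖ = 1)
    (hf' : ∀ v, f' v = a * inner ℝ ν v) (hΓ : ∀ᶠ z in 𝓝 y, (z ∈ Γ ↔ f z = 0)) :
    ∃ s : ℝ, x = y + s • ν ∧ |s| = dist x y := by
  have hfy : f y = 0 := hΓ.self_of_nhds.1 hy
  have hext : IsLocalExtrOn (fun z => ‖z - x‖ ^ 2) {z | f z = f y} y := by
    left
    have h1 : ∀ᶠ z in 𝓝[{z | f z = f y}] y, (z ∈ Γ ↔ f z = 0) := nhdsWithin_le_nhds hΓ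
    filter_upwards [h1, self_mem_nhdsWithin] with z hz hzf
    have hzΓ : z ∈ Γ := hz.2 (by rw [← hfy]; exact hzf)
    have := hmin z hzΓ
    rw [dist_comm x y, dist_comm x z, dist_eq_norm, dist_eq_norm] at this
    gcongr
  have hstr : HasStrictFDerivAt (fun z => ‖z - x‖ ^ 2) _ y :=
    (hasStrictFDerivAt_norm_sq (y - x)).comp y ((hasStrictFDerivAt_id y).sub_const x)
  obtain ⟨α, β, hαβ, hlin⟩ := hext.exists_multipliers_of_hasStrictFDerivAt_1d hf hstr
  have hlin' : ∀ v, α * (a * inner ℝ ν v) + β * (2 * inner ℝ (y - x) v) = 0 := by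
    intro v
    have := congrArg (fun A : E →L[ℝ] ℝ => A v) hlin
    simpa [hf', inner_sub_left] using this
  have hβ : β ≠ 0 := by
    rintro rfl
    have := hlin' ν
    rw [real_inner_self_eq_norm_sq, hν] at this
    have hα : α = 0 := by simpa [ha] using this
    exact hαβ (by simp [hα])
  have hx : x = y + (α * a / (2 * β)) • ν := by
    have : y - x + (α * a / (2 * β)) • ν = 0 := by
      refine ext_inner_right ℝ fun v => ?_
      rw [inner_add_left, inner_zero_left, real_inner_smul_left]
      have h := hlin' v
      field_simp
      linarith
    rw [← sub_eq_zero, ← neg_eq_zero, ← this]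
    abel
  refine ⟨_, hx, ?_⟩
  conv_rhs => rw [hx]
  simp [norm_smul, hν, abs_div, abs_mul]

end NormalCoordinates

/-! ### The signed distance function in the tubular neighbourhood -/

theorem abs_signedDistFun (Γ D : Set E3) (x : E3) : |signedDistFun Γ D x| = infDist x Γ := by
  unfold signedDistFun
  split_ifs <;> simp [abs_of_nonneg infDist_nonneg]

theorem signedDistFun_eq_of_sign {Γ D : Set E3} {x : E3} {s : ℝ} (hs : |s| = infDist x Γ)
    (hpos : 0 < s → x ∉ D) (hneg : s < 0 → x ∈ D) : signedDistFun Γ D x = s := by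
  unfold signedDistFun
  rw [← hs]
  rcases lt_trichotomy s 0 with h | h | h
  · rw [if_pos (hneg h), abs_of_neg h, neg_neg]
  · simp [h]
  · rw [if_neg (hpos h), abs_of_pos h]

theorem notMem_of_signedDistFun_pos {Γ D : Set E3} {x : E3} (h : 0 < signedDistFun Γ D x) :
    x ∉ D := by
  intro hx
  have : signedDistFun Γ D x = -infDist x Γ := if_pos hx
  linarith [infDist_nonneg (x := x) (s := Γ)]

theorem mem_of_signedDistFun_neg {Γ D : Set E3} {x : E3} (h : signedDistFun Γ D x < 0) :
    x ∈ D := by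
  by_contra hx
  have : signedDistFun Γ D x = infDist x Γ := if_neg hx
  linarith [infDist_nonneg (x := x) (s := Γ)]

namespace IsClosedC2Surface

variable {Γ D : Set E3}

theorem nonempty (hΓ : IsClosedC2Surface Γ D) : Γ.Nonempty := hΓ.isConnected.nonempty

theorem mem_iff_signedDistFun_eq_zero (hΓ : IsClosedC2Surface Γ D) {x : E3} :
    x ∈ Γ ↔ signedDistFun Γ D x = 0 := by
  rw [hΓ.isCompact.isClosed.mem_iff_infDist_zero hΓ.nonempty, ← abs_signedDistFun Γ D, abs_eq_zero]

theorem mem_thickening_iff (hΓ : IsClosedC2Surface Γ D) {x : E3} {r : ℝ} :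
    x ∈ thickening r Γ ↔ |signedDistFun Γ D x| < r := by
  rw [mem_thickening_iff_infDist_lt hΓ.nonempty, abs_signedDistFun]

/-- Near the surface, the signed distance function is `C²`: its gradient is a `C¹` unit field. In
normal coordinates `(P, R)` the signed distance is `R`, since nearest points are foot points of
normals. -/
theorem contDiffAt_normalField (hΓ : IsClosedC2Surface Γ D) {y₀ : E3} (hy₀ : y₀ ∈ Γ) :
    ContDiffAt ℝ 1 (normalField Γ D) y₀ ∧ ∀ᶠ x in 𝓝 y₀,
      HasGradientAt (signedDistFun Γ D) (normalField Γ D x) x ∧ ‖normalField Γ D x‖ = 1 := by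
  obtain ⟨f, hf, hf', hfΓ, hfD⟩ := hΓ.exists_defining_function hy₀
  have hgrad : ContDiffAt ℝ 1 (gradient f) y₀ :=
    (InnerProductSpace.toDual ℝ E3).symm.contDiff.contDiffAt.comp y₀
      (hf.fderiv_right (m := 1) (by norm_num))
  have hg0 : gradient f y₀ ≠ 0 := by
    intro h
    apply hf'
    rw [← toDual_gradient, h, map_zero]
  have hne : ∀ᶠ y in 𝓝 y₀, gradient f y ≠ 0 := hgrad.continuousAt.eventually_ne hg0
  set N : E3 → E3 := fun y => ‖gradient f y‖⁻¹ • gradient f y with hN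
  have hNc : ContDiffAt ℝ 1 N y₀ :=
    ((hgrad.norm ℝ hg0).inv (norm_ne_zero_iff.2 hg0)).smul hgrad
  have hN1 : ∀ᶠ y in 𝓝 y₀, ‖N y‖ = 1 := by
    filter_upwards [hne] with y hy
    simp [hN, norm_smul, hy]
  have hfN' : ∀ᶠ y in 𝓝 y₀, ‖gradient f y‖ ≠ 0 ∧
      ∀ v, fderiv ℝ f y v = ‖gradient f y‖ * inner ℝ (N y) v := by
    filter_upwards [hne] with y hy
    have hy' := norm_ne_zero_iff.2 hy
    refine ⟨hy', fun v => ?_⟩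
    rw [hN, real_inner_smul_left, inner_gradient_left, mul_inv_cancel_left₀ hy']
  have hf0 : f y₀ = 0 := hfΓ.self_of_nhds.1 hy₀
  obtain ⟨P, R, hP, hP0, -, -, hcoord, huniq⟩ := exists_normal_coordinates (f := f) (N := N) 0
    (hf.of_le (by norm_num)) hNc hN1 (hfN'.mono fun y hy => ⟨_, hy⟩) hf0
    (fun v _ hv => by simpa using hv)
  simp only [zero_smul, add_zero] at hP hP0 hcoord
  have hstrict : ∀ᶠ y in 𝓝 y₀, HasStrictFDerivAt f (fderiv ℝ f y) y :=
    (hf.eventually (by simp)).mono fun y hy => hy.hasStrictFDerivAt (by norm_num)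
  -- `f (y + s N(y))` has the sign of `s`
  have hline : Continuous (fun q : E3 × E3 × ℝ => (q.2.1 + q.2.2 • q.1, q.2.1)) := by fun_prop
  have hNt : Filter.Tendsto (fun p : E3 × ℝ => (N p.1, p)) (𝓝 (y₀, 0)) (𝓝 (N y₀, (y₀, 0))) := by
    have h1 : ContinuousAt (fun p : E3 × ℝ => N p.1) (y₀, 0) :=
      ContinuousAt.comp (f := Prod.fst) (x := (y₀, (0 : ℝ))) hNc.continuousAt continuousAt_fst
    exact (h1.prodMk continuousAt_id).tendsto
  have hline0 : Filter.Tendsto (fun p : E3 × ℝ => (p.1 + p.2 • N p.1, p.1)) (𝓝 (y₀, 0))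
      (𝓝 (y₀, y₀)) := by
    have := (hline.tendsto (N y₀, (y₀, 0))).comp hNt
    simpa [Function.comp_def] using this
  set m : ℝ := fderiv ℝ f y₀ (N y₀) with hm
  have hm0 : 0 < m := by
    rw [hm, hfN'.self_of_nhds.2, real_inner_self_eq_norm_sq, hN1.self_of_nhds]
    simpa using hg0
  have hsign : ∀ᶠ p : E3 × ℝ in 𝓝 (y₀, 0), f p.1 = 0 →
      (0 < p.2 → 0 < f (p.1 + p.2 • N p.1)) ∧ (p.2 < 0 → f (p.1 + p.2 • N p.1) < 0) := by
    have h1 := hline0.eventually ((hf.hasStrictFDerivAt (by norm_num)).isLittleO.def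
      (c := m / 4) (by positivity))
    have h2 : ∀ᶠ y in 𝓝 y₀, m / 2 < fderiv ℝ f y₀ (N y) :=
      ((fderiv ℝ f y₀).continuous.continuousAt.comp hNc.continuousAt).eventually_const_lt
        (by simp only [Function.comp_apply]; linarith)
    have hfst : Filter.Tendsto (Prod.fst : E3 × ℝ → E3) (𝓝 (y₀, 0)) (𝓝 y₀) :=
      continuous_fst.tendsto (y₀, (0 : ℝ))
    filter_upwards [h1, hfst.eventually h2, hfst.eventually hN1] with p hp1 hp2 hp3 hp0
    simp only [add_sub_cancel_left, map_smul, smul_eq_mul, norm_smul, hp0, hp3, sub_zero, mul_one,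
      Real.norm_eq_abs] at hp1
    have hp4 := abs_le.1 hp1
    constructor
    · intro h
      rw [abs_of_pos h] at hp4
      nlinarith [mul_lt_mul_of_pos_left hp2 h, mul_pos h hm0]
    · intro h
      rw [abs_of_neg h] at hp4
      nlinarith [mul_lt_mul_of_neg_left hp2 h, mul_neg_of_neg_of_pos h hm0]
  have hφR : ∀ᶠ x in 𝓝 y₀, signedDistFun Γ D x = R x := by
    have hfst : Filter.Tendsto (Prod.fst : E3 × ℝ → E3) (𝓝 (y₀, 0)) (𝓝 y₀) :=
      continuous_fst.tendsto (y₀, (0 : ℝ))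
    have hev := (hsign.and huniq).and (hfst.eventually ((hstrict.and hN1).and
      (hfN'.and (eventually_eventually_nhds.2 hfΓ))))
    obtain ⟨ρ, hρ, hball⟩ := Metric.eventually_nhds_iff_ball.1 hev
    filter_upwards [ball_mem_nhds y₀ (half_pos hρ), hfD, hcoord] with x hx hxD hxc
    obtain ⟨y, hy, hyx⟩ := hΓ.isCompact.exists_infDist_eq_dist hΓ.nonempty x
    have hmin : ∀ z ∈ Γ, dist x y ≤ dist x z := fun z hz => hyx ▸ infDist_le_dist_of_mem hz
    have hxy : dist x y < ρ / 2 := (hmin y₀ hy₀).trans_lt hx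
    have hyy₀ : dist y y₀ < ρ := by
      have := dist_triangle y x y₀
      rw [dist_comm y x] at this
      have hx' : dist x y₀ < ρ / 2 := hx
      linarith
    have hbal : ∀ s : ℝ, |s| < ρ → (y, s) ∈ ball (y₀, (0 : ℝ)) ρ := by
      intro s hs
      rw [← ball_prod_same]
      exact ⟨hyy₀, by simpa using hs⟩
    obtain ⟨-, ⟨hst, hn⟩, ⟨hne', hfn⟩, hΓy⟩ := hball _ (hbal 0 (by simpa using hρ))
    obtain ⟨s, hxs, hs⟩ := exists_eq_add_smul_normal hy hmin hst hne' hn hfn hΓy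
    have hsρ : |s| < ρ := by rw [hs]; linarith
    obtain ⟨⟨hsg, hun⟩, -⟩ := hball _ (hbal s hsρ)
    have hfy : f y = 0 := hΓy.self_of_nhds.1 hy
    have hR : R x = s := by rw [hxs]; exact (hun hfy).2
    rw [hR]
    have hsg' := hsg hfy
    simp only [← hxs] at hsg'
    refine signedDistFun_eq_of_sign (by rw [hs, hyx]) (fun h hD => ?_) (fun h => ?_)
    · exact absurd (hxD.1 hD) (not_lt.2 (hsg'.1 h).le)
    · exact hxD.2 (hsg'.2 h)
  have hgr : ∀ᶠ x in 𝓝 y₀, HasGradientAt (signedDistFun Γ D) (N (P x)) x := by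
    filter_upwards [hcoord, eventually_eventually_nhds.2 hφR] with x hx hx'
    exact hx.2.2.1.congr_of_eventuallyEq hx'
  have hnN : normalField Γ D =ᶠ[𝓝 y₀] fun x => N (P x) :=
    hgr.mono fun x hx => hx.gradient
  have hPt : Filter.Tendsto P (𝓝 y₀) (𝓝 y₀) := by
    have := hP.continuousAt.tendsto
    rwa [hP0] at this
  refine ⟨ContDiffAt.congr_of_eventuallyEq ?_ hnN, ?_⟩
  · have hNP : ContDiffAt ℝ 1 N (P y₀) := by rw [hP0]; exact hNc
    exact hNP.comp y₀ hP
  · filter_upwards [hgr, hnN, hPt.eventually hN1] with x h1 h2 h3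
    rw [h2]
    exact ⟨h1, h3⟩

theorem norm_normalField_of_mem (hΓ : IsClosedC2Surface Γ D) {y : E3} (hy : y ∈ Γ) :
    ‖normalField Γ D y‖ = 1 :=
  (hΓ.contDiffAt_normalField hy).2.self_of_nhds.2

/-- Every point is reached from one of its nearest points of `Γ` by going the signed distance along
the normal. The side on which the point lies is found by following the open segment from the
nearest point, which does not meet `Γ`. -/
theorem exists_eq_add_signedDistFun_smul (hΓ : IsClosedC2Surface Γ D) (x : E3) :
    ∃ y ∈ Γ, x = y + signedDistFun Γ D x • normalField Γ D y := by
  obtain ⟨y, hy, hyx⟩ := hΓ.isCompact.exists_infDist_eq_dist hΓ.nonempty x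
  obtain ⟨hn, hev⟩ := hΓ.contDiffAt_normalField hy
  have hmin : ∀ z ∈ Γ, dist x y ≤ dist x z := fun z hz => hyx ▸ infDist_le_dist_of_mem hz
  set ν := normalField Γ D y with hν
  have hν1 : ‖ν‖ = 1 := hΓ.norm_normalField_of_mem hy
  have hφy : signedDistFun Γ D y = 0 := hΓ.mem_iff_signedDistFun_eq_zero.1 hy
  have hgy : HasFDerivAt (signedDistFun Γ D) (innerSL ℝ ν) y :=
    hev.self_of_nhds.1.hasFDerivAt
  have hstr : HasStrictFDerivAt (signedDistFun Γ D) (innerSL ℝ ν) y := by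
    refine hasStrictFDerivAt_of_hasFDerivAt_of_continuousAt
      (f' := fun z => innerSL ℝ (normalField Γ D z)) ?_ ?_
    · exact hev.mono fun z hz => hz.1.hasFDerivAt
    · exact (innerSL ℝ (E := E3)).continuous.continuousAt.comp hn.continuousAt
  obtain ⟨s, hxs, hs⟩ := exists_eq_add_smul_normal (a := 1) hy hmin hstr one_ne_zero hν1
    (fun v => by simp) (Filter.Eventually.of_forall fun z => hΓ.mem_iff_signedDistFun_eq_zero)
  refine ⟨y, hy, ?_⟩
  suffices h : signedDistFun Γ D x = s by rw [h, ← hxs]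
  rcases eq_or_ne s 0 with rfl | hs0
  · have : x = y := by simpa using hxs
    rw [this, hφy]
  -- close to `y`, the signed distance has the sign of `s`
  have hsmall : ∀ᶠ t : ℝ in 𝓝 0, |signedDistFun Γ D (y + (t * s) • ν) - t * s| ≤ |t * s| / 2 := by
    have h1 := (hasFDerivAt_iff_isLittleO_nhds_zero.1 hgy).def (c := 1 / 2) (by norm_num)
    have hc : Continuous (fun t : ℝ => (t * s) • ν) := by fun_prop
    have h2 : Filter.Tendsto (fun t : ℝ => (t * s) • ν) (𝓝 0) (𝓝 0) := by
      simpa using hc.tendsto 0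
    filter_upwards [h2.eventually h1] with t ht
    simp only [hφy, sub_zero, map_smul, innerSL_apply_apply, real_inner_self_eq_norm_sq, hν1,
      norm_smul, Real.norm_eq_abs, smul_eq_mul, one_pow, mul_one] at ht
    linarith
  obtain ⟨ρ, hρ, hball⟩ := Metric.eventually_nhds_iff_ball.1 hsmall
  set t := min (ρ / 2) 1 with ht
  have ht0 : 0 < t := lt_min (half_pos hρ) one_pos
  have ht1 : t ≤ 1 := min_le_right _ _
  have hts := hball t (by
    rw [mem_ball_zero_iff, Real.norm_eq_abs, abs_of_pos ht0]
    linarith [min_le_left (ρ / 2) 1])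
  have hside : y + (t * s) • ν ∈ D ↔ x ∈ D := by
    have hS : IsPreconnected (segment ℝ (y + (t * s) • ν) x) := (convex_segment _ _).isPreconnected
    refine hS.mem_iff_mem_of_disjoint_frontier hΓ.isOpen_interior ?_ (left_mem_segment _ _ _)
      (right_mem_segment _ _ _)
    rw [hΓ.frontier_interior, Set.disjoint_left]
    intro z hz hzΓ
    rw [segment_eq_image'] at hz
    obtain ⟨θ, hθ, rfl⟩ := hz
    have h1 := hmin _ hzΓ
    rw [← hs, dist_eq_norm] at h1
    have h2 : x - (y + (t * s) • ν + θ • (x - (y + (t * s) • ν)))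
        = ((1 - θ) * (1 - t) * s) • ν := by
      rw [hxs]; module
    rw [h2, norm_smul, hν1, mul_one, Real.norm_eq_abs, abs_mul, abs_mul,
      abs_of_nonneg (by linarith [hθ.2] : 0 ≤ 1 - θ), abs_of_nonneg (by linarith : 0 ≤ 1 - t)] at h1
    have h3 : (1 - θ) * (1 - t) < 1 := by nlinarith [hθ.1, hθ.2]
    have h4 : 0 < |s| := abs_pos.2 hs0
    nlinarith
  refine signedDistFun_eq_of_sign (by rw [hs, hyx]) (fun h => ?_) (fun h => ?_)
  · rw [← hside]
    apply notMem_of_signedDistFun_pos (Γ := Γ)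
    have h1 : 0 < t * s := mul_pos ht0 h
    rw [abs_of_pos h1] at hts
    linarith [(abs_le.1 hts).1]
  · rw [← hside]
    apply mem_of_signedDistFun_neg (Γ := Γ)
    have h1 : t * s < 0 := mul_neg_of_pos_of_neg ht0 h
    rw [abs_of_neg h1] at hts
    linarith [(abs_le.1 hts).2]

theorem inner_hessianField_eq_zero (hΓ : IsClosedC2Surface Γ D) {y : E3} (hy : y ∈ Γ) (v : E3) :
    inner ℝ (normalField Γ D y) (hessianField Γ D y v) = 0 := by
  obtain ⟨hn, hev⟩ := hΓ.contDiffAt_normalField hy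
  exact inner_fderiv_eq_zero_of_norm_eq_one (hn.differentiableAt (by norm_num))
    (hev.mono fun z hz => hz.2) v

theorem inner_hessianField_comm (hΓ : IsClosedC2Surface Γ D) {y : E3} (hy : y ∈ Γ) (v w : E3) :
    inner ℝ (hessianField Γ D y v) w = inner ℝ v (hessianField Γ D y w) := by
  obtain ⟨hn, hev⟩ := hΓ.contDiffAt_normalField hy
  have h1 : HasFDerivAt (fun z => innerSL ℝ (normalField Γ D z))
      ((innerSL ℝ (E := E3)).comp (hessianField Γ D y)) y :=
    (innerSL ℝ (E := E3)).hasFDerivAt.comp y (hn.differentiableAt (by norm_num)).hasFDerivAt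
  have h2 := second_derivative_symmetric_of_eventually
    (hev.mono fun z hz => hz.1.hasFDerivAt) h1 v w
  simp only [ContinuousLinearMap.comp_apply, innerSL_apply_apply] at h2
  rw [h2, real_inner_comm]

/-- The bound on the principal curvatures is a bound on the second fundamental form, by the spectral
theorem in the tangent plane. -/
theorem norm_hessianField_apply_le (hΓ : IsClosedC2Surface Γ D) {δ : ℝ}
    (hδ : IsAdmissibleWidth Γ D δ) {y : E3} (hy : y ∈ Γ) {u : E3}
    (hu : inner ℝ (normalField Γ D y) u = 0) : 2 * δ * ‖hessianField Γ D y u‖ ≤ ‖u‖ := by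
  set ν := normalField Γ D y with hν
  set H := hessianField Γ D y with hH
  have hδ0 := hδ.pos
  have hν0 : ν ≠ 0 := by
    rw [← norm_ne_zero_iff, hΓ.norm_normalField_of_mem hy]; exact one_ne_zero
  set V : Submodule ℝ E3 := (ℝ ∙ ν)ᗮ with hV
  have hmemV : ∀ v, v ∈ V ↔ inner ℝ ν v = 0 := fun v =>
    Submodule.mem_orthogonal_singleton_iff_inner_right
  have : Fact (Module.finrank ℝ E3 = 2 + 1) := ⟨by simp⟩
  have hdim : Module.finrank ℝ V = 2 := Submodule.finrank_orthogonal_span_singleton hν0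
  have hinv : ∀ v ∈ V, H.toLinearMap v ∈ V := fun v _ =>
    (hmemV _).2 (hΓ.inner_hessianField_eq_zero hy v)
  have hsymm : H.toLinearMap.IsSymmetric := fun v w => hΓ.inner_hessianField_comm hy v w
  have hT := hsymm.restrict_invariant hinv
  set T := H.toLinearMap.restrict hinv with hTdef
  set b := hT.eigenvectorBasis hdim with hb
  set κ := hT.eigenvalues hdim with hκ
  have hTb : ∀ i, T (b i) = κ i • b i := fun i => by
    rw [hb, hT.apply_eigenvectorBasis]; rfl
  have hHb : ∀ i, H (b i : E3) = κ i • (b i : E3) := fun i => congrArg Subtype.val (hTb i)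
  have hprin : ArePrincipalCurvatures Γ D y (κ 0) (κ 1) := by
    refine ⟨b 0, b 1, ?_, ?_, ?_, ?_, ?_, hHb 0, hHb 1⟩
    · exact b.orthonormal.1 0
    · exact b.orthonormal.1 1
    · exact b.orthonormal.2 (by simp : (0 : Fin 2) ≠ 1)
    · rw [real_inner_comm]; exact (hmemV _).1 (b 0).2
    · rw [real_inner_comm]; exact (hmemV _).1 (b 1).2
  have hκle := hδ.curvature_le y hy _ _ hprin
  have hκi : ∀ i, (2 * δ * κ i) ^ 2 ≤ 1 := by
    intro i
    have h1 : 2 * δ * |κ i| ≤ 1 := by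
      fin_cases i
      · exact le_trans (by gcongr; exact le_add_of_nonneg_right (abs_nonneg _)) hκle
      · exact le_trans (by gcongr; exact le_add_of_nonneg_left (abs_nonneg _)) hκle
    rw [sq_le_one_iff_abs_le_one, abs_mul, abs_of_pos (by positivity : 0 < 2 * δ)]
    exact h1
  set w : V := ⟨u, (hmemV u).2 hu⟩ with hw
  have hTw : ‖(2 * δ) • T w‖ ^ 2 ≤ ‖w‖ ^ 2 := by
    rw [← b.sum_sq_norm_inner_right, ← b.sum_sq_norm_inner_right w]
    refine Finset.sum_le_sum fun i _ => ?_
    have h1 : inner ℝ (b i) ((2 * δ) • T w) = (2 * δ * κ i) * inner ℝ (b i) w := by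
      rw [inner_smul_right, ← hT (b i) w, hTb, real_inner_smul_left]
      ring
    rw [h1, norm_mul, mul_pow, Real.norm_eq_abs, sq_abs]
    exact mul_le_of_le_one_left (by positivity) (hκi i)
  have h2 := (sq_le_sq₀ (norm_nonneg _) (norm_nonneg _)).1 hTw
  rw [norm_smul, Real.norm_eq_abs, abs_of_pos (by positivity : 0 < 2 * δ)] at h2
  exact h2

variable {δ : ℝ}

theorem signedDistFun_add_smul (hΓ : IsClosedC2Surface Γ D) (hδ : IsAdmissibleWidth Γ D δ)
    {y : E3} (hy : y ∈ Γ) {r : ℝ} (hr : |r| < δ) :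
    signedDistFun Γ D (y + r • normalField Γ D y) = r := by
  set x := y + r • normalField Γ D y with hx
  obtain ⟨z, hz, hxz⟩ := hΓ.exists_eq_add_signedDistFun_smul x
  have hlt : |signedDistFun Γ D x| < δ := by
    rw [abs_signedDistFun]
    refine lt_of_le_of_lt (infDist_le_dist_of_mem hy) ?_
    simpa [hx, norm_smul, hΓ.norm_normalField_of_mem hy] using hr
  exact (hδ.unique_decomposition y hy z hz r _ hr hlt (hx ▸ hxz)).2.symm

/-- In the tubular neighbourhood, the signed distance function is twice differentiable, its
gradient is constant along normals, and the curvature bound on `Γ` controls its Hessian up to the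
edge. -/
theorem normalField_add_smul (hΓ : IsClosedC2Surface Γ D) (hδ : IsAdmissibleWidth Γ D δ)
    {y : E3} (hy : y ∈ Γ) {r : ℝ} (hr : |r| < δ) :
    normalField Γ D (y + r • normalField Γ D y) = normalField Γ D y ∧
    HasGradientAt (signedDistFun Γ D) (normalField Γ D y) (y + r • normalField Γ D y) ∧
    DifferentiableAt ℝ (normalField Γ D) (y + r • normalField Γ D y) ∧
    ‖hessianField Γ D (y + r • normalField Γ D y)‖ ≤ 1 / δ := by
  obtain ⟨hn, hev⟩ := hΓ.contDiffAt_normalField hy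
  have hδ0 := hδ.pos
  have hφc : ContDiffAt ℝ 1 (signedDistFun Γ D) y := by
    rw [show (1 : WithTop ℕ∞) = (0 : ℕ) + 1 by norm_num, contDiffAt_succ_iff_hasFDerivAt]
    refine ⟨fun z => innerSL ℝ (normalField Γ D z), ?_, ?_⟩
    · refine ⟨_, hev, fun z hz => ?_⟩
      exact hz.1.hasFDerivAt
    · exact (innerSL ℝ (E := E3)).contDiff.contDiffAt.comp y (hn.of_le (by norm_num))
  have hrH : ∀ w, inner ℝ (normalField Γ D y) w = 0 →
      ‖r • hessianField Γ D y w‖ ≤ ‖w‖ / 2 := by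
    intro w hw
    have h1 := hΓ.norm_hessianField_apply_le hδ hy hw
    rw [norm_smul, Real.norm_eq_abs]
    have h2 : |r| * ‖hessianField Γ D y w‖ ≤ δ * ‖hessianField Γ D y w‖ := by gcongr
    linarith
  obtain ⟨P, R, hP, hP0, hR0, hRc, hcoord, -⟩ := exists_normal_coordinates
    (f := signedDistFun Γ D) (N := normalField Γ D) (y₀ := y) r hφc hn
    (hev.mono fun z hz => hz.2)
    (hev.mono fun z hz => ⟨1, one_ne_zero, fun v => by rw [hz.1.fderiv_apply, one_mul]⟩)
    (hΓ.mem_iff_signedDistFun_eq_zero.1 hy) (fun v hv h0 => by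
      have h1 := hrH v hv
      have h2 : v = -(r • hessianField Γ D y v) := eq_neg_of_add_eq_zero_left h0
      have h3 : ‖v‖ = ‖r • hessianField Γ D y v‖ := by
        conv_lhs => rw [h2, norm_neg]
      rw [← norm_le_zero_iff]
      linarith)
  set x₀ := y + r • normalField Γ D y with hx₀
  have hRδ : ∀ᶠ x in 𝓝 x₀, |R x| < δ := by
    refine hRc.abs.eventually_lt continuousAt_const ?_
    rwa [hR0]
  have hφR : ∀ᶠ x in 𝓝 x₀, signedDistFun Γ D x = R x := by
    filter_upwards [hRδ, hcoord] with x h1 h2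
    have hPΓ : P x ∈ Γ := hΓ.mem_iff_signedDistFun_eq_zero.2 h2.1
    conv_lhs => rw [h2.2.1]
    exact hΓ.signedDistFun_add_smul hδ hPΓ h1
  have hgr : ∀ᶠ x in 𝓝 x₀, HasGradientAt (signedDistFun Γ D) (normalField Γ D (P x)) x := by
    filter_upwards [hcoord, eventually_eventually_nhds.2 hφR] with x h1 h2
    exact h1.2.2.1.congr_of_eventuallyEq h2
  have hnP : normalField Γ D =ᶠ[𝓝 x₀] fun x => normalField Γ D (P x) :=
    hgr.mono fun x hx => hx.gradient
  have hPd : DifferentiableAt ℝ P x₀ := hP.differentiableAt (by norm_num)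
  have hnd : HasFDerivAt (normalField Γ D) (hessianField Γ D y) (P x₀) := by
    rw [hP0]; exact (hn.differentiableAt (by norm_num)).hasFDerivAt
  have hD : HasFDerivAt (normalField Γ D) ((hessianField Γ D y).comp (fderiv ℝ P x₀)) x₀ :=
    (hnd.comp x₀ hPd.hasFDerivAt).congr_of_eventuallyEq hnP
  have hx1 := hnP.self_of_nhds
  have hx2 := hgr.self_of_nhds
  simp only [hP0] at hx1 hx2
  refine ⟨hx1, hx2, hD.differentiableAt, ?_⟩
  have hH : hessianField Γ D x₀ = (hessianField Γ D y).comp (fderiv ℝ P x₀) := hD.fderiv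
  rw [hH]
  refine ContinuousLinearMap.opNorm_le_bound _ (by positivity) fun v => ?_
  rw [ContinuousLinearMap.comp_apply]
  obtain ⟨-, -, -, hid⟩ := hcoord.self_of_nhds
  have hidv := hid v
  rw [hP0, hR0] at hidv
  set w := fderiv ℝ P x₀ v with hw
  set ν := normalField Γ D y with hν
  have hν1 : ‖ν‖ = 1 := hΓ.norm_normalField_of_mem hy
  have hνw : inner ℝ ν w = 0 := by
    have h1 := congrArg (fun z => inner ℝ ν z) hidv
    have h2 : inner ℝ ν (fderiv ℝ (normalField Γ D) y w) = 0 :=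
      hΓ.inner_hessianField_eq_zero hy w
    simp only [inner_add_right, inner_smul_right, h2, real_inner_self_eq_norm_sq, hν1] at h1
    linarith
  have h1 := hΓ.norm_hessianField_apply_le hδ hy hνw
  have h2 := hrH w hνw
  have h3 : w = (v - inner ℝ ν v • ν) - r • hessianField Γ D y w := by
    have h4 : v = w + r • hessianField Γ D y w + inner ℝ ν v • ν := hidv
    have h5 : v - inner ℝ ν v • ν = w + r • hessianField Γ D y w := sub_eq_of_eq_add h4
    rw [h5, add_sub_cancel_right]
  have h4 : ‖v - inner ℝ ν v • ν‖ ≤ ‖v‖ := by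
    rw [← sq_le_sq₀ (norm_nonneg _) (norm_nonneg _), norm_sub_sq_real, inner_smul_right,
      norm_smul, hν1, Real.norm_eq_abs, real_inner_comm v ν, mul_one, sq_abs]
    nlinarith [sq_nonneg (inner ℝ ν v)]
  have h5 : ‖w‖ ≤ 2 * ‖v‖ := by
    have : ‖w‖ ≤ ‖v - inner ℝ ν v • ν‖ + ‖r • hessianField Γ D y w‖ := by
      conv_lhs => rw [h3]
      exact norm_sub_le _ _
    linarith
  rw [div_mul_eq_mul_div, one_mul, le_div_iff₀ hδ0]
  linarith

end IsClosedC2Surface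

/-! ### Lipschitz functions and bounded weak derivatives -/

/-- On a convex set, a function that is locally Lipschitz with one constant is Lipschitz with the
same constant. -/
theorem Convex.lipschitzOnWith_of_locally {E F : Type*} [NormedAddCommGroup E] [NormedSpace ℝ E]
    [PseudoMetricSpace F] {s : Set E} (hs : Convex ℝ s) {L : NNReal} {f : E → F}
    (hf : ∀ x ∈ s, ∃ u ∈ 𝓝[s] x, LipschitzOnWith L f u) : LipschitzOnWith L f s := by
  refine LipschitzOnWith.of_dist_le_mul fun x hx y hy => ?_
  set γ : ℝ → E := fun t => x + t • (y - x) with hγ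
  have hγc : Continuous γ := by fun_prop
  have hγs : ∀ t ∈ Icc (0 : ℝ) 1, γ t ∈ s := fun t ht => by
    have := hs.add_smul_sub_mem hx hy ht
    exact this
  have hγd : ∀ a b : ℝ, dist (γ a) (γ b) = |a - b| * dist x y := by
    intro a b
    have h1 : γ a - γ b = (a - b) • (y - x) := by simp only [hγ]; module
    rw [dist_eq_norm, h1, norm_smul, dist_comm x y, dist_eq_norm, Real.norm_eq_abs]
  have hfc : ContinuousOn f s := by
    intro z hz
    obtain ⟨u, hu, hL⟩ := hf z hz
    exact (hL.continuousOn z (mem_of_mem_nhdsWithin hz hu)).mono_of_mem_nhdsWithin hu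
  have hgc : ContinuousOn (fun t => f (γ t)) (Icc 0 1) :=
    hfc.comp hγc.continuousOn hγs
  have key : Icc (0 : ℝ) 1 ⊆ {t | dist (f (γ 0)) (f (γ t)) ≤ L * (t * dist x y)} := by
    refine IsClosed.Icc_subset_of_forall_exists_gt ?_ ?_ ?_
    · have h1 : ContinuousOn (fun t => dist (f (γ 0)) (f (γ t)) - L * (t * dist x y)) (Icc 0 1) :=
        (continuous_dist.comp_continuousOn (continuousOn_const.prodMk hgc)).sub (by fun_prop)
      have h2 := h1.preimage_isClosed_of_isClosed isClosed_Icc (isClosed_Iic (a := (0 : ℝ)))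
      convert h2 using 1
      ext t
      simp [and_comm]
    · simp
    · rintro t ⟨ht, ht01⟩ b hb
      obtain ⟨u, hu, hL⟩ := hf (γ t) (hγs t ⟨ht01.1, ht01.2.le⟩)
      have htend : Filter.Tendsto γ (𝓝[>] t) (𝓝[s] (γ t)) := by
        refine tendsto_nhdsWithin_iff.2 ⟨(hγc.tendsto t).mono_left nhdsWithin_le_nhds, ?_⟩
        filter_upwards [Ioo_mem_nhdsGT ht01.2] with a ha
        exact hγs a ⟨ht01.1.trans ha.1.le, ha.2.le⟩
      have hev : ∀ᶠ a in 𝓝[>] t, γ a ∈ u ∧ a ∈ Ioc t b :=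
        (htend.eventually hu).and (Ioc_mem_nhdsGT hb)
      obtain ⟨a, hau, hab⟩ := hev.exists
      refine ⟨a, ?_, hab⟩
      have htu : γ t ∈ u := mem_of_mem_nhdsWithin (hγs t ⟨ht01.1, ht01.2.le⟩) hu
      have h1 := hL.dist_le_mul _ htu _ hau
      rw [hγd, abs_sub_comm, abs_of_nonneg (by linarith [hab.1] : 0 ≤ a - t)] at h1
      have h2 : dist (f (γ 0)) (f (γ t)) ≤ L * (t * dist x y) := ht
      have h3 := dist_triangle (f (γ 0)) (f (γ t)) (f (γ a))
      rw [mem_ofPred_eq]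
      linarith
  have h := key (right_mem_Icc.2 zero_le_one)
  simpa [hγ] using h

theorem LipschitzOnWith.smul_of_norm_le {X F : Type*} [PseudoMetricSpace X] [NormedAddCommGroup F]
    [NormedSpace ℝ F] {s : Set X} {a : X → ℝ} {b : X → F} {Ka Kb A B : NNReal}
    (ha : LipschitzOnWith Ka a s) (hb : LipschitzOnWith Kb b s) (hA : ∀ x ∈ s, ‖a x‖ ≤ A)
    (hB : ∀ x ∈ s, ‖b x‖ ≤ B) :
    LipschitzOnWith (Ka * B + A * Kb) (fun x => a x • b x) s := by
  refine LipschitzOnWith.of_dist_le_mul fun x hx y hy => ?_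
  have h1 : a x • b x - a y • b y = (a x - a y) • b x + a y • (b x - b y) := by module
  have h2 := ha.dist_le_mul x hx y hy
  have h3 := hb.dist_le_mul x hx y hy
  rw [dist_eq_norm] at h2 h3
  rw [dist_eq_norm, h1]
  push_cast
  calc ‖(a x - a y) • b x + a y • (b x - b y)‖
      ≤ ‖a x - a y‖ * ‖b x‖ + ‖a y‖ * ‖b x - b y‖ := by
        refine (norm_add_le _ _).trans ?_
        rw [norm_smul, norm_smul]
    _ ≤ (Ka * dist x y) * B + A * (Kb * dist x y) := by
        gcongr
        · exact hB x hx
        · exact hA y hy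
    _ = (Ka * B + A * Kb) * dist x y := by ring

theorem norm_le_of_ae_norm_le_of_continuousOn {X F : Type*} [TopologicalSpace X]
    [MeasurableSpace X] [NormedAddCommGroup F]
    {μ : Measure X} [μ.IsOpenPosMeasure] {U : Set X} (hU : IsOpen U) {f : X → F}
    (hf : ContinuousOn f U) {M : ℝ} (h : ∀ᵐ x ∂μ.restrict U, ‖f x‖ ≤ M) :
    ∀ x ∈ U, ‖f x‖ ≤ M := by
  have hopen : IsOpen (U ∩ f ⁻¹' {y | M < ‖y‖}) :=
    hf.isOpen_inter_preimage hU (isOpen_lt continuous_const continuous_norm)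
  have h0 : μ (U ∩ f ⁻¹' {y | M < ‖y‖}) = 0 := by
    rw [ae_iff] at h
    refine le_antisymm ?_ (zero_le)
    calc μ (U ∩ f ⁻¹' {y | M < ‖y‖}) = μ ((f ⁻¹' {y | M < ‖y‖}) ∩ U) := by rw [inter_comm]
      _ ≤ μ.restrict U (f ⁻¹' {y | M < ‖y‖}) := Measure.le_restrict_apply _ _
      _ = 0 := by simpa [preimage, not_le] using h
  have hempty := hopen.eq_empty_of_measure_zero h0
  intro x hx
  by_contra hcon
  have : x ∈ U ∩ f ⁻¹' {y | M < ‖y‖} := ⟨hx, not_le.1 hcon⟩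
  rw [hempty] at this
  exact this

theorem ae_norm_le_of_supNorm_le {F : Type*} [NormedAddCommGroup F] {U : Set E3} {f : E3 → F}
    {M : ℝ} (hM : 0 ≤ M) (h : supNorm U f ≤ ENNReal.ofReal M) :
    ∀ᵐ x ∂volume.restrict U, ‖f x‖ ≤ M := by
  rw [supNorm, eLpNorm_exponent_top] at h
  filter_upwards [ae_le_eLpNormEssSup (f := f) (μ := volume.restrict U)] with x hx
  have h1 := hx.trans h
  rwa [← ofReal_norm, ENNReal.ofReal_le_ofReal_iff hM] at h1

theorem supNorm_le_ofReal {F : Type*} [NormedAddCommGroup F] {U : Set E3} {f : E3 → F}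
    {M : ℝ} (h : ∀ᵐ x ∂volume.restrict U, ‖f x‖ ≤ M) : supNorm U f ≤ ENNReal.ofReal M := by
  rw [supNorm, eLpNorm_exponent_top]
  exact eLpNormEssSup_le_of_ae_bound h

open scoped Convolution in
/-- A continuous function with bounded weak gradient is locally Lipschitz with the same bound as
constant: its mollifications have bounded gradients. -/
theorem HasWeakFDeriv.exists_lipschitzOnWith {U : Set E3} (hU : IsOpen U) {e : E3 → ℝ}
    {g : E3 → E3 →L[ℝ] ℝ} (he : HasWeakFDeriv U e g) (hec : ContinuousOn e U) {L : NNReal}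
    (hg : ∀ᵐ x ∂volume.restrict U, ‖g x‖ ≤ L) {x₀ : E3} (hx₀ : x₀ ∈ U) :
    ∃ u ∈ 𝓝 x₀, LipschitzOnWith L e u := by
  obtain ⟨R, hR, hRU⟩ := Metric.isOpen_iff.1 hU x₀ hx₀
  set r := R / 4 with hr
  have hr0 : 0 < r := by positivity
  have hKU : closedBall x₀ (2 * r) ⊆ U :=
    (closedBall_subset_ball (by rw [hr]; linarith)).trans hRU
  set B := ball x₀ (2 * r) with hB
  have hBU : B ⊆ U := ball_subset_closedBall.trans hKU
  set e₁ : E3 → ℝ := B.indicator e with he₁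
  have he₁i : Integrable e₁ := by
    rw [he₁, integrable_indicator_iff isOpen_ball.measurableSet]
    exact ((hec.mono hKU).integrableOn_compact (isCompact_closedBall _ _)).mono_set
      ball_subset_closedBall
  refine ⟨ball x₀ r, ball_mem_nhds x₀ hr0, ?_⟩
  -- a mollifier of small radius gives a function with gradient bounded by `L` on the ball
  have hmoll : ∀ φ : ContDiffBump (0 : E3), φ.rOut < r → ∀ x ∈ ball x₀ r, ∀ y ∈ ball x₀ r,
      ‖(φ.normed volume ⋆[ContinuousLinearMap.lsmul ℝ ℝ, volume] e₁) y
        - (φ.normed volume ⋆[ContinuousLinearMap.lsmul ℝ ℝ, volume] e₁) x‖ ≤ L * ‖y - x‖ := by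
    intro φ hφ x hx y hy
    set η := φ.normed (volume : Measure E3) with hη
    have hηc : ContDiff ℝ ∞ η := φ.contDiff_normed
    have hηs : HasCompactSupport η := φ.hasCompactSupport_normed
    set f := η ⋆[ContinuousLinearMap.lsmul ℝ ℝ, volume] e₁ with hf
    have hf' : f = e₁ ⋆[(ContinuousLinearMap.lsmul ℝ ℝ).flip, volume] η := by
      rw [hf, ← convolution_flip]
    have hder : ∀ z ∈ ball x₀ r, ∃ f' : E3 →L[ℝ] ℝ, HasFDerivAt f f' z ∧ ‖f'‖ ≤ L := by
      intro z hz
      refine ⟨_, hf' ▸ hηs.hasFDerivAt_convolution_right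
        (ContinuousLinearMap.lsmul ℝ ℝ).flip he₁i.locallyIntegrable (hηc.of_le (by simp)) z, ?_⟩
      refine ContinuousLinearMap.opNorm_le_bound _ L.coe_nonneg fun v => ?_
      rw [convolution_precompR_apply _ he₁i.locallyIntegrable (hηs.fderiv ℝ)
        (hηc.continuous_fderiv (by simp)), convolution_def]
      simp only [ContinuousLinearMap.flip_apply, ContinuousLinearMap.lsmul_apply]
      -- the test function of the weak derivative is the mollifier centred at `z`
      set ψ : E3 → ℝ := fun t => η (z - t) with hψ
      have hψc : ContDiff ℝ ∞ ψ := hηc.comp (contDiff_const.sub contDiff_id)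
      have hψs : tsupport ψ ⊆ closedBall z φ.rOut := by
        refine closure_minimal (fun t ht => ?_) isClosed_closedBall
        have h1 : z - t ∈ Function.support η := ht
        rw [hη, φ.support_normed_eq, mem_ball_zero_iff] at h1
        rw [mem_closedBall, dist_comm, dist_eq_norm]
        exact h1.le
      have hψB : tsupport ψ ⊆ B := by
        refine hψs.trans fun t ht => ?_
        rw [hB, mem_ball]
        rw [mem_closedBall] at ht
        rw [mem_ball] at hz
        linarith [dist_triangle t z x₀]
      have hψcs : HasCompactSupport ψ :=
        (isCompact_closedBall z φ.rOut).of_isClosed_subset (isClosed_tsupport _) hψs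
      have hψd : ∀ t, fderiv ℝ ψ t v = -fderiv ℝ η (z - t) v := by
        intro t
        have h1 : HasFDerivAt ψ ((fderiv ℝ η (z - t)).comp (-ContinuousLinearMap.id ℝ E3)) t :=
          HasFDerivAt.comp t ((hηc.differentiable (by simp)) _).hasFDerivAt
            ((hasFDerivAt_id t).const_sub z)
        rw [h1.fderiv]
        simp
      have hweak := he.integral_eq ψ hψc hψcs (hψB.trans hBU) v
      have hleft : ∫ t, fderiv ℝ η (z - t) v • e₁ t = ∫ t in U, ψ t • g t v := by
        have h1 : ∫ t in U, (fderiv ℝ ψ t v) • e t = ∫ t, (fderiv ℝ ψ t v) • e₁ t := by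
          have h2 : ∀ t, t ∉ U → (fderiv ℝ ψ t v) • e₁ t = 0 := fun t ht => by
            rw [he₁, indicator_of_notMem (fun h => ht (hBU h)), smul_zero]
          rw [← setIntegral_eq_integral_of_forall_compl_eq_zero h2]
          refine setIntegral_congr_fun hU.measurableSet fun t _ => ?_
          by_cases htB : t ∈ B
          · simp only [he₁, indicator_of_mem htB]
          · have h3 : fderiv ℝ ψ t = 0 :=
              image_eq_zero_of_notMem_tsupport
                fun h => htB (hψB (tsupport_fderiv_subset ℝ h))
            simp [h3]
        rw [h1] at hweak
        simp only [hψd, neg_smul, integral_neg, neg_inj] at hweak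
        exact hweak
      rw [hleft]
      have hψi : Integrable ψ := hψc.continuous.integrable_of_hasCompactSupport hψcs
      have hψ0 : ∀ t, 0 ≤ ψ t := fun t => φ.nonneg_normed _
      have hψ1 : ∫ t, ψ t = 1 := by
        rw [hψ, integral_sub_left_eq_self η volume z]
        exact φ.integral_normed
      calc ‖∫ t in U, ψ t • g t v‖ ≤ ∫ t in U, ψ t * (L * ‖v‖) := by
            refine norm_integral_le_of_norm_le (hψi.integrableOn.mul_const _) ?_
            filter_upwards [hg] with t ht
            rw [norm_smul, Real.norm_eq_abs, abs_of_nonneg (hψ0 t)]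
            have := (g t).le_of_opNorm_le ht v
            gcongr
            exact hψ0 t
        _ = (∫ t in U, ψ t) * (L * ‖v‖) := integral_mul_const _ _
        _ ≤ 1 * (L * ‖v‖) := by
            gcongr
            rw [← hψ1]
            exact setIntegral_le_integral hψi (Filter.Eventually.of_forall hψ0)
        _ = L * ‖v‖ := one_mul _
    choose! f' hf'd hf'n using hder
    exact (convex_ball x₀ r).norm_image_sub_le_of_norm_hasFDerivWithin_le
      (fun z hz => (hf'd z hz).hasFDerivWithinAt) hf'n hx hy
  let φ : ℕ → ContDiffBump (0 : E3) := fun k =>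
    { rIn := r / (k + 2) / 2
      rOut := r / (k + 2)
      rIn_pos := by positivity
      rIn_lt_rOut := half_lt_self (by positivity) }
  have hφr : Filter.Tendsto (fun k => (φ k).rOut) Filter.atTop (𝓝 0) := by
    have h1 : Filter.Tendsto (fun k : ℕ => (k : ℝ) + 2) Filter.atTop Filter.atTop :=
      Filter.tendsto_atTop_add_const_right _ _ tendsto_natCast_atTop_atTop
    exact h1.const_div_atTop r
  have hφlt : ∀ k, (φ k).rOut < r := by
    intro k
    change r / (k + 2) < r
    rw [div_lt_iff₀ (by positivity)]
    nlinarith [(Nat.cast_nonneg k : (0 : ℝ) ≤ k)]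
  have hlim : ∀ x ∈ ball x₀ r, Filter.Tendsto
      (fun k => ((φ k).normed volume ⋆[ContinuousLinearMap.lsmul ℝ ℝ, volume] e₁) x)
      Filter.atTop (𝓝 (e x)) := by
    intro x hx
    have hxB : B ∈ 𝓝 x := isOpen_ball.mem_nhds (ball_subset_ball (by linarith) hx)
    have h1 : Filter.Tendsto e₁ (𝓝 x) (𝓝 (e x)) := by
      have h2 : ContinuousAt e x := hec.continuousAt (Filter.mem_of_superset hxB hBU)
      refine Filter.Tendsto.congr' ?_ h2.tendsto
      filter_upwards [hxB] with z hz
      rw [he₁, indicator_of_mem hz]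
    exact ContDiffBump.convolution_tendsto_right hφr
      (Filter.Eventually.of_forall fun _ => he₁i.aestronglyMeasurable)
      (h1.comp Filter.tendsto_snd) tendsto_const_nhds
  refine LipschitzOnWith.of_dist_le_mul fun x hx y hy => ?_
  rw [dist_eq_norm, dist_eq_norm]
  exact le_of_tendsto ((hlim x hx).sub (hlim y hy)).norm
    (Filter.Eventually.of_forall fun k => hmoll (φ k) (hφlt k) y hy x hx)

theorem ae_restrict_differentiableAt_of_locally_lipschitz {U : Set E3} (hU : IsOpen U)
    {F : E3 → E3} {K : NNReal} (hF : ∀ x ∈ U, ∃ u ∈ 𝓝 x, LipschitzOnWith K F u) :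
    ∀ᵐ x ∂volume.restrict U, DifferentiableAt ℝ F x := by
  rw [ae_restrict_iff' hU.measurableSet, ae_iff]
  refine measure_null_of_locally_null _ fun x hx => ?_
  have hxU : x ∈ U := by
    by_contra h
    exact hx fun hxU => absurd hxU h
  obtain ⟨u, hu, hL⟩ := hF x hxU
  obtain ⟨w, hwu, hw, hxw⟩ := _root_.mem_nhds_iff.1 hu
  refine ⟨_, Filter.inter_mem self_mem_nhdsWithin (mem_nhdsWithin_of_mem_nhds (hw.mem_nhds hxw)), ?_⟩
  have h1 := (hL.mono hwu).ae_differentiableWithinAt_of_mem (μ := volume)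
  refine measure_mono_null ?_ (ae_iff.1 h1)
  rintro z ⟨hz, hzw⟩ hcon
  exact hz fun _ => (hcon hzw).differentiableAt (hw.mem_nhds hzw)

/-- The derivative of a compactly supported Lipschitz map has mean zero. -/
theorem LipschitzWith.integral_fderiv_apply_eq_zero {f : E3 → E3} {K : NNReal}
    (hf : LipschitzWith K f) (hfs : HasCompactSupport f) (v : E3) :
    ∫ x, fderiv ℝ f x v = 0 := by
  have hd : ∀ᵐ x, DifferentiableAt ℝ f x := hf.ae_differentiableAt
  have hint : Integrable (fun x => fderiv ℝ f x v) := by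
    have h1 : IntegrableOn (fun x => fderiv ℝ f x v) (tsupport f) := by
      refine IntegrableOn.of_bound hfs.isCompact.measure_lt_top
        ((measurable_fderiv_apply_const ℝ f v).aestronglyMeasurable) (K * ‖v‖) ?_
      exact Filter.Eventually.of_forall fun x =>
        (fderiv ℝ f x).le_of_opNorm_le (norm_fderiv_le_of_lipschitz ℝ hf) v
    rwa [integrableOn_iff_integrable_of_support_subset] at h1
    intro x hx
    refine tsupport_fderiv_subset ℝ (subset_tsupport _ fun h0 => hx ?_)
    simp [h0]
  refine ext_inner_left ℝ fun a => ?_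
  rw [inner_zero_right, ← integral_inner hint]
  set fa : E3 → ℝ := fun x => inner ℝ a (f x) with hfa
  have hLa : LipschitzWith (‖innerSL ℝ a‖₊ * K) fa := (innerSL ℝ a).lipschitz.comp hf
  have hsa : HasCompactSupport fa := hfs.comp_left (by simp)
  have h1 := LipschitzWith.integral_lineDeriv_mul_eq (μ := (volume : Measure E3))
    (LipschitzWith.const (1 : ℝ) : LipschitzWith 0 fun _ : E3 => (1 : ℝ)) hLa hsa (-v)
  have hconst : ∀ x : E3, lineDeriv ℝ (fun _ : E3 => (1 : ℝ)) x (-v) = 0 := fun x => by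
    simp [lineDeriv]
  simp only [hconst, zero_mul, integral_zero, neg_neg, mul_one] at h1
  rw [h1]
  refine integral_congr_ae ?_
  filter_upwards [hd] with x hx
  have h2 : HasFDerivAt fa ((innerSL ℝ a).comp (fderiv ℝ f x)) x :=
    (innerSL ℝ a).hasFDerivAt.comp x hx.hasFDerivAt
  rw [h2.differentiableAt.lineDeriv_eq_fderiv, h2.fderiv]
  rfl

/-- A bounded map on a bounded open set that is locally Lipschitz with one constant is in
`W^{1,∞}`, and its weak derivative is its derivative, which exists almost everywhere. -/
theorem isW1InfWith_of_locally_lipschitz {U : Set E3} (hU : IsOpen U)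
    (hUb : Bornology.IsBounded U) {F : E3 → E3} {G : E3 → E3 →L[ℝ] E3} {K M M' : NNReal}
    (hF : ∀ x ∈ U, ∃ u ∈ 𝓝 x, LipschitzOnWith K F u) (hFM : ∀ x ∈ U, ‖F x‖ ≤ M)
    (hGm : Measurable G) (hGM : ∀ x ∈ U, ‖G x‖ ≤ M')
    (hGF : ∀ x ∈ U, DifferentiableAt ℝ F x → G x = fderiv ℝ F x) : IsW1InfWith U F G := by
  have hUm := hU.measurableSet
  have hFc : ContinuousOn F U := by
    intro x hx
    obtain ⟨u, hu, hL⟩ := hF x hx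
    exact (hL.continuousOn.continuousAt hu).continuousWithinAt
  have hFp : MemLp F ∞ (volume.restrict U) :=
    memLp_top_of_bound (hFc.aestronglyMeasurable hUm) M
      ((ae_restrict_iff' hUm).2 (Filter.Eventually.of_forall hFM))
  have hGp : MemLp G ∞ (volume.restrict U) :=
    memLp_top_of_bound hGm.aestronglyMeasurable M'
      ((ae_restrict_iff' hUm).2 (Filter.Eventually.of_forall hGM))
  have : IsFiniteMeasure (volume.restrict U) :=
    isFiniteMeasure_restrict.2 hUb.measure_lt_top.ne
  have hFi : Integrable F (volume.restrict U) := hFp.integrable le_top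
  have hGi : Integrable G (volume.restrict U) := hGp.integrable le_top
  refine ⟨⟨IntegrableOn.locallyIntegrableOn hFi, IntegrableOn.locallyIntegrableOn hGi, ?_⟩,
    hFp, hGp⟩
  intro ψ hψ hψs hψU v
  obtain ⟨Kψ, hKψ⟩ := hψ.lipschitzWith_of_hasCompactSupport hψs (by simp)
  obtain ⟨A, hA⟩ := hψs.exists_bound_of_continuous hψ.continuous
  -- the product with the test function is globally Lipschitz, with compact support
  set f : E3 → E3 := fun x => ψ x • F x with hf
  set C : NNReal := Kψ * M + A.toNNReal * K with hC
  have hfl : LipschitzWith C f := by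
    rw [← lipschitzOnWith_univ]
    refine convex_univ.lipschitzOnWith_of_locally fun x _ => ?_
    rw [nhdsWithin_univ]
    by_cases hx : x ∈ U
    · obtain ⟨u, hu, hL⟩ := hF x hx
      refine ⟨u ∩ U, Filter.inter_mem hu (hU.mem_nhds hx), ?_⟩
      exact (hKψ.lipschitzOnWith).smul_of_norm_le (hL.mono inter_subset_left)
        (fun z _ => (hA z).trans (Real.le_coe_toNNReal A)) fun z hz => hFM z hz.2
    · refine ⟨(tsupport ψ)ᶜ, (isClosed_tsupport ψ).isOpen_compl.mem_nhds
        (fun h => hx (hψU h)), ?_⟩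
      refine LipschitzOnWith.of_dist_le_mul fun y hy z hz => ?_
      simp only [hf, image_eq_zero_of_notMem_tsupport hy, image_eq_zero_of_notMem_tsupport hz,
        zero_smul, dist_self]
      positivity
  have hfs : HasCompactSupport f := hψs.smul_right
  have hfU : tsupport f ⊆ U := (tsupport_smul_subset_left ψ F).trans hψU
  have h0 : ∫ x in U, fderiv ℝ f x v = 0 := by
    rw [setIntegral_eq_integral_of_forall_compl_eq_zero,
      hfl.integral_fderiv_apply_eq_zero hfs]
    intro x hx
    rw [image_eq_zero_of_notMem_tsupport fun h => hx (hfU (tsupport_fderiv_subset ℝ h))]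
    simp
  have hae : ∀ᵐ x ∂volume.restrict U,
      fderiv ℝ f x v = (fderiv ℝ ψ x v) • F x + ψ x • G x v := by
    filter_upwards [ae_restrict_differentiableAt_of_locally_lipschitz hU hF,
      ae_restrict_mem hUm] with x hx hxU
    have h1 : HasFDerivAt f _ x :=
      (hψ.differentiable (by simp) x).hasFDerivAt.smul hx.hasFDerivAt
    rw [h1.fderiv, hGF x hxU hx]
    simp [add_comm]
  rw [integral_congr_ae hae, integral_add] at h0
  · exact eq_neg_of_add_eq_zero_left h0
  · obtain ⟨A', hA'⟩ := (hψs.fderiv ℝ).exists_bound_of_continuous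
      (hψ.continuous_fderiv (by simp))
    refine hFi.bdd_smul (A' * ‖v‖)
      ((hψ.continuous_fderiv (by simp)).clm_apply continuous_const).aestronglyMeasurable ?_
    exact Filter.Eventually.of_forall fun x => (fderiv ℝ ψ x).le_of_opNorm_le (hA' x) v
  · refine Integrable.bdd_smul (hGi.apply_continuousLinearMap v) A
      hψ.continuous.aestronglyMeasurable ?_
    exact Filter.Eventually.of_forall hA

/-! ### The correction of the height, and the displacement along the normals -/

/-- The piecewise linear bound `A(s)` of the correction: it is at least `ε` for `s ≤ 0` and
vanishes for `s ≥ d`. -/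
noncomputable def clampMargin (ε d s : ℝ) : ℝ := max 0 (ε - ε / d * s)

/-- The correction of the height `s` by the error `e`, clamped so that adding it maps the heights in
the discrete band onto `(-d, d)`. Here `τ` is the distance from the height `d` to the edge of the
tubular neighbourhood, and `ε` bounds `|e|`. At positive heights only the lower clamp can
be active, and it keeps the corrected height above `s - τ`, up to a margin that vanishes as `s`
approaches the upper edge `d + τ` of the tubular neighbourhood; negative heights are treated
symmetrically. -/
noncomputable def bandCorrection (τ ε d s e : ℝ) : ℝ :=
  max (-(τ + clampMargin ε d s)) (min e (τ + clampMargin ε d (-s)))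

theorem clampMargin_nonneg (ε d s : ℝ) : 0 ≤ clampMargin ε d s := le_max_left _ _

theorem le_clampMargin_of_nonpos {ε d s : ℝ} (hε : 0 ≤ ε) (hd : 0 < d) (hs : s ≤ 0) :
    ε ≤ clampMargin ε d s := by
  have : 0 ≤ ε / d := by positivity
  exact le_trans (by nlinarith) (le_max_right _ _)

theorem clampMargin_le {ε d s δ : ℝ} (hε : 0 ≤ ε) (hd : 0 < d) (hεd : ε ≤ d) (hdδ : d ≤ δ)
    (hs : s ≤ δ) : clampMargin ε d s ≤ δ - s := by
  have h1 : ε / d ≤ 1 := (div_le_one hd).2 hεd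
  have h2 : 0 ≤ ε / d := by positivity
  have h3 : ε - ε / d * s = ε / d * (d - s) := by field_simp
  refine max_le (by linarith) ?_
  rw [h3]
  rcases le_total s d with h | h
  · nlinarith
  · nlinarith

theorem abs_clampMargin_sub_le {ε d : ℝ} (hε : 0 ≤ ε) (hd : 0 < d) (s s' : ℝ) :
    |clampMargin ε d s - clampMargin ε d s'| ≤ ε / d * |s - s'| := by
  have h2 : 0 ≤ ε / d := by positivity
  refine (abs_max_sub_max_le_max _ _ _ _).trans (max_le (by simpa using by positivity) ?_)
  rw [show ε - ε / d * s - (ε - ε / d * s') = -(ε / d * (s - s')) by ring, abs_neg, abs_mul,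
    abs_of_nonneg h2]

theorem bandCorrection_neg {τ : ℝ} (hτ : 0 ≤ τ) (ε d s e : ℝ) :
    bandCorrection τ ε d (-s) (-e) = -bandCorrection τ ε d s e := by
  have h1 := clampMargin_nonneg ε d s
  have h2 := clampMargin_nonneg ε d (-s)
  simp only [bandCorrection, neg_neg]
  grind

theorem abs_bandCorrection_le {τ : ℝ} (hτ : 0 ≤ τ) (ε d s e : ℝ) :
    |bandCorrection τ ε d s e| ≤ |e| := by
  have h1 := clampMargin_nonneg ε d s
  have h2 := clampMargin_nonneg ε d (-s)
  simp only [bandCorrection]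
  grind

theorem abs_bandCorrection_sub_le {τ ε d : ℝ} (hε : 0 ≤ ε) (hd : 0 < d) (s s' e e' : ℝ) :
    |bandCorrection τ ε d s e - bandCorrection τ ε d s' e'| ≤ |e - e'| + ε / d * |s - s'| := by
  have h1 := abs_clampMargin_sub_le hε hd s s'
  have h2 := abs_clampMargin_sub_le hε hd (-s) (-s')
  rw [show -s - -s' = -(s - s') by ring, abs_neg] at h2
  have h3 : 0 ≤ ε / d * |s - s'| := by positivity
  have h4 := abs_nonneg (e - e')
  refine (abs_max_sub_max_le_max _ _ _ _).trans (max_le ?_ ?_)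
  · rw [show -(τ + clampMargin ε d s) - -(τ + clampMargin ε d s')
      = -(clampMargin ε d s - clampMargin ε d s') by ring, abs_neg]
    linarith
  · refine (abs_min_sub_min_le_max _ _ _ _).trans (max_le (by linarith) ?_)
    rw [add_sub_add_left_eq_sub]
    linarith

/-- Inside the tubular neighbourhood, the corrected height and the discrete height cut out the same
band. -/
theorem abs_add_bandCorrection_lt_iff {ε d δ s e : ℝ} (hε : 0 ≤ ε) (hd : 0 < d) (hεd : ε < d)
    (hdδ : d ≤ δ) (hs : |s| < δ) (he : |e| ≤ ε) :
    |s + bandCorrection (δ - d) ε d s e| < d ↔ |s + e| < d := by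
  have key : ∀ s e : ℝ, 0 ≤ s → |s| < δ → |e| ≤ ε →
      (|s + bandCorrection (δ - d) ε d s e| < d ↔ |s + e| < d) := by
    intro s e hs0 hs he
    have h1 := clampMargin_nonneg ε d s
    have h2 := le_clampMargin_of_nonpos hε hd (neg_nonpos.2 hs0)
    have h3 := abs_lt.1 hs
    have h4 := abs_le.1 he
    have h5 : min e (δ - d + clampMargin ε d (-s)) = e := min_eq_left (by linarith)
    rw [bandCorrection, h5, abs_lt, abs_lt]
    rcases le_total (-(δ - d + clampMargin ε d s)) e with h | h
    · rw [max_eq_right h]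
    · rw [max_eq_left h]
      constructor
      · intro _; constructor <;> linarith
      · intro _; constructor <;> linarith
  rcases le_total 0 s with h | h
  · exact key s e h hs he
  · have h1 := key (-s) (-e) (neg_nonneg.2 h) (by rwa [abs_neg]) (by rwa [abs_neg])
    rwa [bandCorrection_neg (by linarith), ← neg_add, ← neg_add, abs_neg, abs_neg] at h1

theorem le_add_bandCorrection {ε d δ s : ℝ} (hε : 0 ≤ ε) (hd : 0 < d) (hεd : ε ≤ d) (hdδ : d ≤ δ)
    (hs : s ≤ δ) (e : ℝ) : d - 2 * (δ - s) ≤ s + bandCorrection (δ - d) ε d s e := by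
  have h1 := clampMargin_le hε hd hεd hdδ hs
  have h2 : -(δ - d + clampMargin ε d s) ≤ bandCorrection (δ - d) ε d s e := le_max_left _ _
  linarith

theorem add_bandCorrection_le {ε d δ s : ℝ} (hε : 0 ≤ ε) (hd : 0 < d) (hεd : ε ≤ d) (hdδ : d ≤ δ)
    (hs : -δ ≤ s) (e : ℝ) : s + bandCorrection (δ - d) ε d s e ≤ -(d - 2 * (δ + s)) := by
  have h1 := le_add_bandCorrection hε hd hεd hdδ (neg_le.1 hs) (-e)
  rw [bandCorrection_neg (by linarith)] at h1
  linarith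

theorem exists_lipschitzOnWith_of_norm_fderiv_le {E F : Type*} [NormedAddCommGroup E]
    [NormedSpace ℝ E] [NormedAddCommGroup F] [NormedSpace ℝ F] {f : E → F} {T : Set E}
    (hT : IsOpen T) {K : NNReal} (hf : ∀ x ∈ T, DifferentiableAt ℝ f x ∧ ‖fderiv ℝ f x‖ ≤ K)
    {x : E} (hx : x ∈ T) : ∃ u ∈ 𝓝 x, LipschitzOnWith K f u := by
  obtain ⟨r, hr, hrT⟩ := Metric.isOpen_iff.1 hT x hx
  exact ⟨ball x r, ball_mem_nhds x hr, (convex_ball x r).lipschitzOnWith_of_nnnorm_fderiv_le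
    (fun z hz => (hf z (hrT hz)).1) fun z hz => (hf z (hrT hz)).2⟩

namespace IsClosedC2Surface

variable {Γ D : Set E3}

theorem continuous_signedDistFun (hΓ : IsClosedC2Surface Γ D) :
    Continuous (signedDistFun Γ D) := by
  classical
  have h : Continuous fun x => if x ∈ D then -infDist x Γ else infDist x Γ := by
    refine Continuous.if (fun a ha => ?_) (continuous_infDist_pt Γ).neg (continuous_infDist_pt Γ)
    have haΓ : a ∈ Γ := hΓ.frontier_interior ▸ ha
    rw [infDist_zero_of_mem haΓ, neg_zero]
  convert h using 1
  ext x
  unfold signedDistFun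
  congr

variable {δ : ℝ}

/-- The points of the tubular neighbourhood in normal coordinates: foot point `y` and height
`φ(x)`. -/
theorem exists_foot (hΓ : IsClosedC2Surface Γ D) (hδ : IsAdmissibleWidth Γ D δ) {x : E3}
    (hx : x ∈ thickening δ Γ) : ∃ y ∈ Γ, |signedDistFun Γ D x| < δ ∧
      x = y + signedDistFun Γ D x • normalField Γ D y ∧
      normalField Γ D x = normalField Γ D y := by
  obtain ⟨y, hy, hxy⟩ := hΓ.exists_eq_add_signedDistFun_smul x
  have hlt := hΓ.mem_thickening_iff.1 hx
  refine ⟨y, hy, hlt, hxy, ?_⟩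
  conv_lhs => rw [hxy]
  exact (hΓ.normalField_add_smul hδ hy hlt).1

theorem add_smul_mem_thickening (hΓ : IsClosedC2Surface Γ D) (hδ : IsAdmissibleWidth Γ D δ)
    {y : E3} (hy : y ∈ Γ) {r d : ℝ} (hr : |r| < d) (hd : d ≤ δ) :
    y + r • normalField Γ D y ∈ thickening d Γ := by
  rw [hΓ.mem_thickening_iff, hΓ.signedDistFun_add_smul hδ hy (hr.trans_le hd)]
  exact hr

theorem norm_normalField (hΓ : IsClosedC2Surface Γ D) (hδ : IsAdmissibleWidth Γ D δ) {x : E3}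
    (hx : x ∈ thickening δ Γ) : ‖normalField Γ D x‖ = 1 := by
  obtain ⟨y, hy, -, -, hn⟩ := hΓ.exists_foot hδ hx
  rw [hn, hΓ.norm_normalField_of_mem hy]

theorem exists_lipschitzOnWith_signedDistFun (hΓ : IsClosedC2Surface Γ D)
    (hδ : IsAdmissibleWidth Γ D δ) {x : E3} (hx : x ∈ thickening δ Γ) :
    ∃ u ∈ 𝓝 x, LipschitzOnWith 1 (signedDistFun Γ D) u := by
  refine exists_lipschitzOnWith_of_norm_fderiv_le isOpen_thickening (fun z hz => ?_) hx
  obtain ⟨y, hy, hr, hzy, -⟩ := hΓ.exists_foot hδ hz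
  have h := (hΓ.normalField_add_smul hδ hy hr).2.1
  rw [← hzy] at h
  refine ⟨h.differentiableAt, ?_⟩
  rw [h.hasFDerivAt.fderiv, LinearIsometryEquiv.norm_map, hΓ.norm_normalField_of_mem hy]
  simp

theorem exists_lipschitzOnWith_normalField (hΓ : IsClosedC2Surface Γ D)
    (hδ : IsAdmissibleWidth Γ D δ) {x : E3} (hx : x ∈ thickening δ Γ) :
    ∃ u ∈ 𝓝 x, LipschitzOnWith (1 / δ).toNNReal (normalField Γ D) u := by
  refine exists_lipschitzOnWith_of_norm_fderiv_le isOpen_thickening (fun z hz => ?_) hx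
  obtain ⟨y, hy, hr, hzy, -⟩ := hΓ.exists_foot hδ hz
  have h := (hΓ.normalField_add_smul hδ hy hr).2.2
  rw [← hzy] at h
  exact ⟨h.1, h.2.trans (Real.le_coe_toNNReal _)⟩

/-- Moving the points of the tubular neighbourhood along the normals by a correction `E` is a
bijection onto the band of half-width `d` from the set where the corrected height is less than `d`
in absolute value, provided that `E` is a contraction and the corrected heights come close to `±d`
at the two ends of each normal. -/
theorem bijOn_add_smul_normalField (hΓ : IsClosedC2Surface Γ D) (hδ : IsAdmissibleWidth Γ D δ)
    {d : ℝ} (hdδ : d ≤ δ) {E : E3 → ℝ} {L : NNReal} (hL1 : L < 1)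
    (hE : ∀ x ∈ thickening δ Γ, ∃ u ∈ 𝓝 x, LipschitzOnWith L E u)
    (hup : ∀ x ∈ thickening δ Γ,
      d - 2 * (δ - signedDistFun Γ D x) ≤ signedDistFun Γ D x + E x)
    (hlow : ∀ x ∈ thickening δ Γ,
      signedDistFun Γ D x + E x ≤ -(d - 2 * (δ + signedDistFun Γ D x))) :
    BijOn (fun x => x + E x • normalField Γ D x)
      {x ∈ thickening δ Γ | |signedDistFun Γ D x + E x| < d} (thickening d Γ) := by
  set φ := signedDistFun Γ D with hφ
  set n := normalField Γ D with hn
  have hδ0 := hδ.pos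
  have hfoot : ∀ x ∈ thickening δ Γ, ∃ y ∈ Γ, |φ x| < δ ∧ x = y + φ x • n y ∧
      x + E x • n x = y + (φ x + E x) • n y := by
    intro x hx
    obtain ⟨y, hy, hr, hxy, hnx⟩ := hΓ.exists_foot hδ hx
    refine ⟨y, hy, hr, hxy, ?_⟩
    rw [hn, hnx, add_smul, ← add_assoc]
    congr 1
  refine ⟨?_, ?_, ?_⟩
  · rintro x ⟨hx, hxd⟩
    obtain ⟨y, hy, -, -, hΦ⟩ := hfoot x hx
    change x + E x • n x ∈ _
    rw [hΦ]
    exact hΓ.add_smul_mem_thickening hδ hy hxd hdδ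
  · rintro x ⟨hx, hxd⟩ x' ⟨hx', hxd'⟩ heq
    obtain ⟨y, hy, hr, hxy, hΦ⟩ := hfoot x hx
    obtain ⟨y', hy', hr', hxy', hΦ'⟩ := hfoot x' hx'
    change x + E x • n x = x' + E x' • n x' at heq
    rw [hΦ, hΦ'] at heq
    obtain ⟨rfl, hw⟩ := hδ.unique_decomposition y hy y' hy' _ _ (hxd.trans_le hdδ)
      (hxd'.trans_le hdδ) heq
    -- the segment between the two points lies on a normal of the tubular neighbourhood
    have hseg : segment ℝ x x' ⊆ thickening δ Γ := by
      intro z hz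
      rw [segment_eq_image'] at hz
      obtain ⟨θ, hθ, rfl⟩ := hz
      have h1 : x + θ • (x' - x) = y + (φ x + θ * (φ x' - φ x)) • n y := by
        nth_rw 1 2 [hxy]
        nth_rw 1 [hxy']
        module
      change x + θ • (x' - x) ∈ _
      rw [h1]
      refine hΓ.add_smul_mem_thickening hδ hy ?_ le_rfl
      have h2 := (convex_ball (0 : ℝ) δ).add_smul_sub_mem (x := φ x) (y := φ x')
        (by simpa using hr) (by simpa using hr') hθ
      simpa using h2
    have hlip := (convex_segment x x').lipschitzOnWith_of_locally (f := E) (L := L) fun z hz => by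
      obtain ⟨u, hu, hLu⟩ := hE z (hseg hz)
      exact ⟨u, mem_nhdsWithin_of_mem_nhds hu, hLu⟩
    have h1 := hlip.dist_le_mul x (left_mem_segment _ _ _) x' (right_mem_segment _ _ _)
    have h2 : dist x x' = |φ x - φ x'| := by
      rw [dist_eq_norm]
      nth_rw 1 [hxy]
      nth_rw 1 [hxy']
      rw [add_sub_add_left_eq_sub, ← sub_smul, norm_smul, hn, hΓ.norm_normalField_of_mem hy,
        mul_one, Real.norm_eq_abs]
    have h3 : E x - E x' = -(φ x - φ x') := by linarith
    rw [h2, Real.dist_eq, h3, abs_neg] at h1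
    have hL1' : (L : ℝ) < 1 := by exact_mod_cast hL1
    have h4 : |φ x - φ x'| = 0 := by nlinarith [abs_nonneg (φ x - φ x')]
    rw [abs_eq_zero, sub_eq_zero] at h4
    rw [hxy, hxy', h4]
  · intro z hz
    obtain ⟨y, hy, -, hzy, -⟩ := hΓ.exists_foot hδ (thickening_mono hdδ Γ hz)
    have htd := hΓ.mem_thickening_iff.1 hz
    set t := signedDistFun Γ D z with ht
    have hdt : |t| ≤ d := htd.le
    -- within `η` of the ends of the normal the corrected height is at least `|t|` in absolute value
    set η := (d - |t|) / 2 with hη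
    have hη0 : 0 < η := by rw [hη]; linarith
    have hηδ : η < δ := by rw [hη]; linarith [abs_nonneg t]
    have hγT : ∀ r ∈ Icc (-(δ - η)) (δ - η), y + r • n y ∈ thickening δ Γ ∧ φ (y + r • n y) = r := by
      intro r hr
      have hrδ : |r| < δ := abs_lt.2 ⟨by linarith [hr.1], by linarith [hr.2]⟩
      exact ⟨hΓ.add_smul_mem_thickening hδ hy hrδ le_rfl, hΓ.signedDistFun_add_smul hδ hy hrδ⟩
    have hEc : ContinuousOn E (thickening δ Γ) := by
      intro x hx
      obtain ⟨u, hu, hLu⟩ := hE x hx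
      exact (hLu.continuousOn.continuousAt hu).continuousWithinAt
    have hwc : ContinuousOn (fun r => r + E (y + r • n y)) (Icc (-(δ - η)) (δ - η)) :=
      continuousOn_id.add (hEc.comp (by fun_prop) fun r hr => (hγT r hr).1)
    have hle : -(δ - η) ≤ δ - η := by linarith
    have hw1 : -(δ - η) + E (y + (-(δ - η)) • n y) ≤ t := by
      obtain ⟨h1, h2⟩ := hγT _ (left_mem_Icc.2 hle)
      have h3 := hlow _ h1
      rw [h2] at h3
      linarith [neg_abs_le t]
    have hw2 : t ≤ (δ - η) + E (y + (δ - η) • n y) := by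
      obtain ⟨h1, h2⟩ := hγT _ (right_mem_Icc.2 hle)
      have h3 := hup _ h1
      rw [h2] at h3
      linarith [le_abs_self t]
    obtain ⟨r, hr, hrt⟩ := intermediate_value_Icc hle hwc ⟨hw1, hw2⟩
    obtain ⟨hxT, hφx⟩ := hγT r hr
    have hrδ : |r| < δ := abs_lt.2 ⟨by linarith [hr.1], by linarith [hr.2]⟩
    simp only at hrt
    refine ⟨y + r • n y, ⟨hxT, ?_⟩, ?_⟩
    · rw [hφx, hrt]
      exact htd
    · change y + r • n y + E (y + r • n y) • n (y + r • n y) = z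
      rw [show n (y + r • n y) = n y from (hΓ.normalField_add_smul hδ hy hrδ).1, hzy, ← hrt,
        add_smul, add_assoc]

theorem projGamma_add_smul (hΓ : IsClosedC2Surface Γ D) (hδ : IsAdmissibleWidth Γ D δ)
    {y : E3} (hy : y ∈ Γ) {r : ℝ} (hr : |r| < δ) :
    projGamma Γ D (y + r • normalField Γ D y) = y := by
  rw [projGamma, hΓ.signedDistFun_add_smul hδ hy hr, (hΓ.normalField_add_smul hδ hy hr).1,
    add_sub_cancel_right]

theorem projGamma_eq_of_add_smul (hΓ : IsClosedC2Surface Γ D) (hδ : IsAdmissibleWidth Γ D δ)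
    {x : E3} (hx : x ∈ thickening δ Γ) {t : ℝ} (ht : |signedDistFun Γ D x + t| < δ) :
    projGamma Γ D (x + t • normalField Γ D x) = projGamma Γ D x := by
  obtain ⟨y, hy, hr, hxy, hn⟩ := hΓ.exists_foot hδ hx
  have h1 : projGamma Γ D x = y := by
    conv_lhs => rw [hxy]
    exact hΓ.projGamma_add_smul hδ hy hr
  have h2 : x + t • normalField Γ D x = y + (signedDistFun Γ D x + t) • normalField Γ D y := by
    rw [hn, add_smul, ← add_assoc]
    congr 1
  rw [h1, h2, hΓ.projGamma_add_smul hδ hy ht]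

end IsClosedC2Surface

/-! ### Sobolev regularity and the error bound -/

/-- Regularity of the displacement along the normals: if the bounded correction `E` is locally
Lipschitz, then `x ↦ x + E(x) n(x)` is in `W^{1,∞}`, with derivative close to the identity. -/
theorem IsClosedC2Surface.isW1InfWith_add_smul_normalField {Γ D : Set E3}
    (hΓ : IsClosedC2Surface Γ D) {δ : ℝ} (hδ : IsAdmissibleWidth Γ D δ) {U : Set E3}
    (hU : IsOpen U) (hUδ : U ⊆ thickening δ Γ) {E : E3 → ℝ} {L ε : NNReal}
    (hE : ∀ x ∈ thickening δ Γ, ∃ u ∈ 𝓝 x, LipschitzOnWith L E u)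
    (hEε : ∀ x ∈ thickening δ Γ, ‖E x‖ ≤ ε) :
    ∃ DΦ : E3 → E3 →L[ℝ] E3, IsW1InfWith U (fun x => x + E x • normalField Γ D x) DΦ ∧
      ∀ x ∈ U, ‖ContinuousLinearMap.id ℝ E3 - DΦ x‖ ≤ L + ε / δ := by
  set F : E3 → E3 := fun x => E x • normalField Γ D x with hF
  have hδ0 := hδ.pos
  set C : NNReal := L * 1 + ε * (1 / δ).toNNReal with hC
  have hC' : (C : ℝ) = L + ε / δ := by
    rw [hC]
    push_cast
    rw [Real.coe_toNNReal _ (by positivity)]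
    ring
  have hFl : ∀ x ∈ U, ∃ u ∈ 𝓝 x, LipschitzOnWith C F u := by
    intro x hx
    obtain ⟨u, hu, hLu⟩ := hE x (hUδ hx)
    obtain ⟨w, hw, hLw⟩ := hΓ.exists_lipschitzOnWith_normalField hδ (hUδ hx)
    refine ⟨u ∩ w ∩ thickening δ Γ, Filter.inter_mem (Filter.inter_mem hu hw)
      (isOpen_thickening.mem_nhds (hUδ hx)), ?_⟩
    exact (hLu.mono fun z hz => hz.1.1).smul_of_norm_le (hLw.mono fun z hz => hz.1.2)
      (fun z hz => hEε z hz.2) fun z hz => by simp [hΓ.norm_normalField hδ hz.2]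
  have hFd : ∀ x ∈ U, ‖fderiv ℝ F x‖ ≤ C := by
    intro x hx
    obtain ⟨u, hu, hLu⟩ := hFl x hx
    exact norm_fderiv_le_of_lipschitzOn ℝ hu hLu
  have hUb : Bornology.IsBounded U := hΓ.isCompact.isBounded.thickening.subset hUδ
  obtain ⟨M, hM⟩ := hUb.exists_norm_le
  refine ⟨fun x => ContinuousLinearMap.id ℝ E3 + fderiv ℝ F x, ?_, fun x hx => ?_⟩
  · refine isW1InfWith_of_locally_lipschitz (K := 1 + C) (M := M.toNNReal + ε) (M' := 1 + C)
      hU hUb ?_ ?_ ?_ ?_ ?_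
    · intro x hx
      obtain ⟨u, hu, hLu⟩ := hFl x hx
      exact ⟨u, hu, (LipschitzWith.id.lipschitzOnWith).add hLu⟩
    · intro x hx
      refine (norm_add_le _ _).trans ?_
      rw [norm_smul, hΓ.norm_normalField hδ (hUδ hx), mul_one, NNReal.coe_add]
      exact add_le_add ((hM x hx).trans (Real.le_coe_toNNReal M)) (hEε x (hUδ hx))
    · exact measurable_const.add (measurable_fderiv ℝ F)
    · intro x hx
      refine (norm_add_le _ _).trans ?_
      rw [NNReal.coe_add]
      exact add_le_add (by simp) (hFd x hx)
    · intro x hx hd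
      have h1 : DifferentiableAt ℝ F x := by
        have h2 : F = (fun z => z + E z • normalField Γ D z) - id := by
          ext1 z
          simp [hF]
        rw [h2]
        exact hd.sub differentiableAt_id
      exact ((hasFDerivAt_id x).add h1.hasFDerivAt).fderiv.symm
  · rw [sub_add_cancel_left, norm_neg, ← hC']
    exact hFd x hx

theorem lemma1 (Γ D Ω : Set E3) (hΓ : IsClosedC2Surface Γ D)
    (δ : ℝ) (hδ : IsAdmissibleWidth Γ D δ)
    (hΩ : IsOpen Ω) (hδΩ : thickening δ Γ ⊆ Ω)
    (q c K : ℝ) (hq : 1 ≤ q) (hc : 0 < c) (hK : 0 < K) :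
    ∃ h₀ : ℝ, 0 < h₀ ∧ ∃ C : ℝ, 0 < C ∧
      ∀ h : ℝ, 0 < h → h ≤ h₀ →
      ∀ d : ℝ, 0 < d → d ≤ δ → h ≤ K * d →
      ∀ (φh : E3 → ℝ) (g : E3 → E3 →L[ℝ] ℝ),
        ContinuousOn φh Ω →
        HasWeakFDeriv Ω (fun x => signedDistFun Γ D x - φh x) g →
        supNorm Ω (fun x => signedDistFun Γ D x - φh x) + ENNReal.ofReal h * supNorm Ω g
          ≤ ENNReal.ofReal (c * h ^ (q + 1)) →
        discreteBand Ω φh d ⊆ thickening δ Γ →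
        ∃ (Φ : E3 → E3) (DΦ : E3 → E3 →L[ℝ] E3),
          BijOn Φ (discreteBand Ω φh d) (thickening d Γ) ∧
          ContinuousOn Φ (discreteBand Ω φh d) ∧
          IsW1InfWith (discreteBand Ω φh d) Φ DΦ ∧
          (∀ x ∈ discreteBand Ω φh d, projGamma Γ D (Φ x) = projGamma Γ D x) ∧
          supNorm (discreteBand Ω φh d) (fun x => x - Φ x)
              + ENNReal.ofReal h * supNorm (discreteBand Ω φh d)
                  (fun x => ContinuousLinearMap.id ℝ E3 - DΦ x)
            ≤ ENNReal.ofReal (C * h ^ (q + 1)) := by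
  have hδ0 := hδ.pos
  refine ⟨min 1 (1 / (2 * c * (1 + K))), by positivity, c + (c * (1 + K) + c / δ), by positivity, ?_⟩
  intro h hh hh₀ d hd hdδ hhd φh g hφh hweak hbound hband
  set φ := signedDistFun Γ D with hφ
  -- the size of `h` makes the correction a contraction of size less than `d`
  have hh1 : h ≤ 1 := hh₀.trans (min_le_left _ _)
  have hh2 : h * (2 * c * (1 + K)) ≤ 1 := by
    rw [← le_div_iff₀ (by positivity)]
    exact hh₀.trans (min_le_right _ _)
  have hq0 : 0 < h ^ q := Real.rpow_pos_of_pos hh q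
  have hqh : h ^ q ≤ h := by
    simpa using Real.rpow_le_rpow_of_exponent_ge hh hh1 hq
  have hq1 : h ^ (q + 1) = h ^ q * h := by rw [Real.rpow_add hh, Real.rpow_one]
  set ε := c * h ^ (q + 1) with hε
  have hε0 : 0 ≤ ε := by rw [hε, hq1]; positivity
  have hεd' : ε ≤ c * K * h ^ q * d := by
    rw [hε, hq1]
    calc c * (h ^ q * h) ≤ c * (h ^ q * (K * d)) := by gcongr
      _ = c * K * h ^ q * d := by ring
  have hcKq : c * (1 + K) * h ^ q ≤ 1 / 2 := by
    have : c * (1 + K) * h ^ q ≤ c * (1 + K) * h := by gcongr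
    linarith
  have hεd : ε < d := by
    have h1 : c * K * h ^ q ≤ 1 / 2 := by nlinarith [mul_pos hc hq0]
    have h2 : c * K * h ^ q * d ≤ 1 / 2 * d := by gcongr
    linarith
  have hεd2 : ε / d ≤ c * K * h ^ q := (div_le_iff₀ hd).2 hεd'
  -- pointwise and Lipschitz bounds for the error
  have hφc : Continuous φ := hΓ.continuous_signedDistFun
  have hec : ContinuousOn (fun x => φ x - φh x) Ω := hφc.continuousOn.sub hφh
  have hesup : ∀ x ∈ Ω, ‖φ x - φh x‖ ≤ ε :=
    norm_le_of_ae_norm_le_of_continuousOn (μ := volume) hΩ hec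
      (ae_norm_le_of_supNorm_le hε0 (le_self_add.trans hbound))
  set L₁ : NNReal := (c * h ^ q).toNNReal with hL₁
  have hL₁' : (L₁ : ℝ) = c * h ^ q := Real.coe_toNNReal _ (by positivity)
  have hgsup : ∀ᵐ x ∂volume.restrict Ω, ‖g x‖ ≤ L₁ := by
    rw [hL₁']
    refine ae_norm_le_of_supNorm_le (by positivity) ?_
    have h1 : ENNReal.ofReal h * supNorm Ω g ≤ ENNReal.ofReal h * ENNReal.ofReal (c * h ^ q) := by
      rw [← ENNReal.ofReal_mul hh.le]
      refine (le_add_self.trans hbound).trans_eq ?_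
      rw [hε, hq1]
      ring_nf
    exact (ENNReal.mul_le_mul_iff_right (by simpa using hh) ENNReal.ofReal_ne_top).1 h1
  set E : E3 → ℝ := fun x => bandCorrection (δ - d) ε d (φ x) (φh x - φ x) with hE
  set L : NNReal := (c * (1 + K) * h ^ q).toNNReal with hL
  have hL' : (L : ℝ) = c * (1 + K) * h ^ q := Real.coe_toNNReal _ (by positivity)
  have hElip : ∀ x ∈ thickening δ Γ, ∃ u ∈ 𝓝 x, LipschitzOnWith L E u := by
    intro x hx
    obtain ⟨u, hu, hLu⟩ := hweak.exists_lipschitzOnWith hΩ hec hgsup (hδΩ hx)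
    obtain ⟨w, hw, hLw⟩ := hΓ.exists_lipschitzOnWith_signedDistFun hδ hx
    refine ⟨u ∩ w, Filter.inter_mem hu hw, LipschitzOnWith.of_dist_le_mul fun y hy z hz => ?_⟩
    have h1 := hLu.dist_le_mul y hy.1 z hz.1
    have h2 := hLw.dist_le_mul y hy.2 z hz.2
    rw [Real.dist_eq] at h1 h2 ⊢
    rw [hL₁'] at h1
    rw [NNReal.coe_one, one_mul] at h2
    refine (abs_bandCorrection_sub_le hε0 hd _ _ _ _).trans ?_
    have h3 : |φh y - φ y - (φh z - φ z)| = |φ y - φh y - (φ z - φh z)| := by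
      rw [← abs_neg]; ring_nf
    rw [h3, hL']
    calc |φ y - φh y - (φ z - φh z)| + ε / d * |φ y - φ z|
        ≤ c * h ^ q * dist y z + c * K * h ^ q * dist y z := by gcongr
      _ = c * (1 + K) * h ^ q * dist y z := by ring
  have hEε : ∀ x ∈ thickening δ Γ, ‖E x‖ ≤ ε := by
    intro x hx
    refine (abs_bandCorrection_le (by linarith) _ _ _ _).trans ?_
    rw [abs_sub_comm]
    exact hesup x (hδΩ hx)
  have hUeq : discreteBand Ω φh d = {x ∈ thickening δ Γ | |φ x + E x| < d} := by
    have hiff : ∀ x ∈ thickening δ Γ, (|φ x + E x| < d ↔ |φh x| < d) := by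
      intro x hx
      have h1 := abs_add_bandCorrection_lt_iff (s := φ x) (e := φh x - φ x) hε0 hd hεd hdδ
        (hΓ.mem_thickening_iff.1 hx) (by rw [abs_sub_comm]; exact hesup x (hδΩ hx))
      rwa [add_sub_cancel] at h1
    ext x
    constructor
    · intro hx
      exact ⟨hband hx, (hiff x (hband hx)).2 hx.2⟩
    · rintro ⟨hx, hxd⟩
      exact ⟨hδΩ hx, (hiff x hx).1 hxd⟩
  have hUo : IsOpen (discreteBand Ω φh d) := by
    have := hφh.abs.isOpen_inter_preimage hΩ (isOpen_Iio (a := d))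
    exact this
  set εn : NNReal := ⟨ε, hε0⟩ with hεn
  obtain ⟨DΦ, hW, hDΦ⟩ := hΓ.isW1InfWith_add_smul_normalField hδ hUo hband hElip (ε := εn) hEε
  refine ⟨fun x => x + E x • normalField Γ D x, DΦ, ?_, ?_, hW, ?_, ?_⟩
  · rw [hUeq]
    refine hΓ.bijOn_add_smul_normalField hδ hdδ (L := L) ?_ hElip (fun x hx => ?_) fun x hx => ?_
    · rw [← NNReal.coe_lt_coe, hL', NNReal.coe_one]
      linarith
    · exact le_add_bandCorrection hε0 hd hεd.le hdδ (abs_lt.1 (hΓ.mem_thickening_iff.1 hx)).2.le _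
    · exact add_bandCorrection_le hε0 hd hεd.le hdδ (abs_lt.1 (hΓ.mem_thickening_iff.1 hx)).1.le _
  · intro x hx
    obtain ⟨u, hu, hLu⟩ := hElip x (hband hx)
    obtain ⟨w, hw, hLw⟩ := hΓ.exists_lipschitzOnWith_normalField hδ (hband hx)
    exact (continuousAt_id.add ((hLu.continuousOn.continuousAt hu).smul
      (hLw.continuousOn.continuousAt hw))).continuousWithinAt
  · intro x hx
    refine hΓ.projGamma_eq_of_add_smul hδ (hband hx) (lt_of_lt_of_le ?_ hdδ)
    rw [hUeq] at hx
    exact hx.2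
  · have h1 : supNorm (discreteBand Ω φh d) (fun x => x - (x + E x • normalField Γ D x))
        ≤ ENNReal.ofReal ε := by
      refine supNorm_le_ofReal ?_
      filter_upwards [ae_restrict_mem hUo.measurableSet] with x hx
      rw [sub_add_cancel_left, norm_neg, norm_smul, hΓ.norm_normalField hδ (hband hx), mul_one]
      exact hEε x (hband hx)
    have h2 : supNorm (discreteBand Ω φh d) (fun x => ContinuousLinearMap.id ℝ E3 - DΦ x)
        ≤ ENNReal.ofReal (L + ε / δ) := by
      refine supNorm_le_ofReal ?_
      filter_upwards [ae_restrict_mem hUo.measurableSet] with x hx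
      exact hDΦ x hx
    calc _ ≤ ENNReal.ofReal ε + ENNReal.ofReal h * ENNReal.ofReal (L + ε / δ) := by gcongr
      _ = ENNReal.ofReal (ε + h * (L + ε / δ)) := by
        rw [← ENNReal.ofReal_mul hh.le, ← ENNReal.ofReal_add hε0 (by positivity)]
      _ ≤ ENNReal.ofReal ((c + (c * (1 + K) + c / δ)) * h ^ (q + 1)) := by
        refine ENNReal.ofReal_le_ofReal ?_
        have h3 : h * (ε / δ) ≤ 1 * (ε / δ) := by gcongr
        have h4 : ε / δ = c / δ * h ^ (q + 1) := by rw [hε]; ring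
        have h5 : h * L = c * (1 + K) * h ^ (q + 1) := by rw [hL', hq1]; ring
        rw [mul_add, h5]
        linarith
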